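/- Let $F$ be a finite field with the discrete topology. Let $\mathcal{Q}$, $\mathcal{Q}_1$, $\mathcal{Q}_2$ be partitions of $\mathbb{Z}$ into (non-empty) finite intervals. For such a partition $\mathcal{Q}$ let $\sharp(\mathcal{Q}) = \{|\mathfrak{p}| : \mathfrak{p}\in\mathcal{Q}\}$ be the set of sizes of its blocks, and let $[\mathcal{Q}]$ be $\mathbb{Z}$ with the preorder: $m\lesssim_{\mathcal{Q}} n$ if $m<n$ or $m,n$ lie in a common block. A set $C\subseteq\mathbb{Z}$ is convex if $i,j\in C$ and $i\lesssim_{\mathcal{Q}}k\lesssim_{\mathcal{Q}}j$ imply $k\in C$. A matrix $(a_{ij})_{i,j\in\mathbb{Z}}$ over $F$ is nonsingular if there is a finite convex set $C_0$ such that $(a_{ij})_{i,j\in C}$ is invertible for every finite convex $C\supseteq C_0$. Let $\mathrm{U}_{[\mathcal{Q}]}(F)$ be the set of nonsingular matrices with $a_{ij}=0$ whenever $i\not\lesssim_{\mathcal{Q}}j$, and let $\mathrm{AU}_{[\mathcal{Q}]}(F)$ be the set of nonsingular matrices with $a_{ij}=0$ for all but finitely many pairs $(i,j)$ such that $i\not\lesssim_{\mathcal{Q}}j$;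 both are groups under matrix multiplication. $\mathrm{U}_{[\mathcal{Q}]}(F)$ carries the topology of entrywise convergence. For finite convex $C$ let $[\mathcal{Q}]+C$ be the preorder generated by $\lesssim_{\mathcal{Q}}$ together with the requirement that all elements of $C$ be equivalent; $\mathrm{AU}_{[\mathcal{Q}]}(F)$ is the union of the groups $\mathrm{U}_{[\mathcal{Q}]+C}(F)$, defined in the same way from $[\mathcal{Q}]+C$, and carries the direct limit topology: a subset is open if and only if its intersection with each $\mathrm{U}_{[\mathcal{Q}]+C}(F)$ is open in the topology of entrywise convergence. Two topological groups $G$ and $H$ are locally isomorphic if there are an open neighbourhood $V$ of the identity in $G$ and an open embedding $\varphi:V\to H$ that is compatible with the group operations as far as they are defined on $V$. (1) Let $n>1$, and $n>2$ if $|F|=3$. There is a continuous surjective homomorphism $\mathrm{U}_{[\mathcal{Q}]}(F)\to\mathrm{PGL}_n(F)$ if and only if $n\in\sharp(\mathcal{Q})$. (2) If $\mathrm{AU}_{[\mathcal{Q}_1]}(F)$ and $\mathrm{AU}_{[\mathcal{Q}_2]}(F)$ are locally isomorphic, then the symmetric difference $\sharp(\mathcal{Q}_1)\,\Delta\,\sharp(\mathcal{Q}_2)$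 is finite. -/

import Mathlib

namespace InfMatrix

section Preorders

variable {Λ : Type*}

/-- `i` is strictly below `j`: `i ≲ j` and not `i ∼ j`. -/
def StrictlyBelow (r : Λ → Λ → Prop) (i j : Λ) : Prop := r i j ∧ ¬ (r i j ∧ r j i)

/-- A set is convex if it contains `[i, j]` for all its elements `i, j`. -/
def IsConvex (r : Λ → Λ → Prop) (s : Set Λ) : Prop :=
  ∀ i ∈ s, ∀ j ∈ s, ∀ k, r i k → r k j → k ∈ s

/-- A set is strongly convex if each point outside lies strictly below all of it or strictly above
all of it. -/
def IsStronglyConvex (r : Λ → Λ → Prop) (s : Set Λ) : Prop :=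
  ∀ i, i ∉ s → (∀ j ∈ s, StrictlyBelow r i j) ∨ (∀ j ∈ s, StrictlyBelow r j i)

/-- A `ℤ`-like preorder: each finite set lies in a finite strongly convex set. -/
class IsZLike (r : Λ → Λ → Prop) : Prop extends IsPreorder Λ r where
  exists_stronglyConvex : ∀ s : Finset Λ, ∃ t : Finset Λ, s ⊆ t ∧ IsStronglyConvex r (t : Set Λ)

/-- The preorder `Λ + Λ'` generated by `≲` and by making all elements of `Λ' = s` equivalent. -/
def adjoin (r : Λ → Λ → Prop) (s : Set Λ) : Λ → Λ → Prop :=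
  Relation.ReflTransGen fun i j => r i j ∨ (i ∈ s ∧ j ∈ s)

theorem IsStronglyConvex.isConvex {r : Λ → Λ → Prop} {s : Set Λ} (h : IsStronglyConvex r s) :
    IsConvex r s := by
  intro i hi j hj k hik hkj
  by_contra hk
  rcases h k hk with h | h
  · exact (h i hi).2 ⟨(h i hi).1, hik⟩
  · exact (h j hj).2 ⟨(h j hj).1, hkj⟩

theorem exists_convex (r : Λ → Λ → Prop) [IsZLike r] (s : Finset Λ) :
    ∃ t : Finset Λ, s ⊆ t ∧ IsConvex r (t : Set Λ) :=
  (IsZLike.exists_stronglyConvex (r := r) s).imp fun _ h => ⟨h.1, h.2.isConvex⟩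

theorem adjoin_iff (r : Λ → Λ → Prop) [IsPreorder Λ r] (s : Set Λ) (i j : Λ) :
    adjoin r s i j ↔ r i j ∨ ∃ x ∈ s, ∃ y ∈ s, r i x ∧ r y j := by
  constructor
  · intro h
    induction h with
    | refl => exact Or.inl (refl_of r i)
    | tail _ h ih =>
      rcases ih with ih | ⟨x, hx, y, hy, h1, h2⟩
      · rcases h with h | ⟨h, h'⟩
        · exact Or.inl (trans_of r ih h)
        · exact Or.inr ⟨_, h, _, h', ih, refl_of r _⟩
      · rcases h with h | ⟨h, h'⟩
        · exact Or.inr ⟨x, hx, y, hy, h1, trans_of r h2 h⟩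
        · exact Or.inr ⟨x, hx, _, h', h1, refl_of r _⟩
  · rintro (h | ⟨x, hx, y, hy, h1, h2⟩)
    · exact Relation.ReflTransGen.single (Or.inl h)
    · exact .trans (.single (Or.inl h1)) (.trans (.single (Or.inr ⟨hx, hy⟩)) (.single (Or.inl h2)))

theorem adjoin_isZLike (r : Λ → Λ → Prop) [IsZLike r] (s : Finset Λ) :
    IsZLike (adjoin r (s : Set Λ)) where
  refl _ := Relation.ReflTransGen.refl
  trans _ _ _ := Relation.ReflTransGen.trans
  exists_stronglyConvex := by
    classical
    intro u
    obtain ⟨t, ht, hc⟩ := IsZLike.exists_stronglyConvex (r := r) (u ∪ s)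
    refine ⟨t, Finset.union_subset_left ht, fun i hi => ?_⟩
    have hs : ∀ x ∈ s, x ∈ t := fun x hx => ht (Finset.mem_union_right _ hx)
    refine (hc i hi).imp (fun h j hj => ?_) (fun h j hj => ?_)
    · refine ⟨(adjoin_iff r _ _ _).2 (Or.inl (h j hj).1), fun h' => ?_⟩
      rcases (adjoin_iff r _ _ _).1 h'.2 with h2 | ⟨x, hx, y, hy, h1, h2⟩
      · exact (h j hj).2 ⟨(h j hj).1, h2⟩
      · exact (h y (hs y hy)).2 ⟨(h y (hs y hy)).1, h2⟩
    · refine ⟨(adjoin_iff r _ _ _).2 (Or.inl (h j hj).1), fun h' => ?_⟩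
      rcases (adjoin_iff r _ _ _).1 h'.2 with h2 | ⟨x, hx, y, hy, h1, h2⟩
      · exact (h j hj).2 ⟨(h j hj).1, h2⟩
      · exact (h x (hs x hx)).2 ⟨(h x (hs x hx)).1, h1⟩

end Preorders

section Matrices

variable {Λ : Type*} {R : Type*} [CommRing R]

/-- The product of `(Λ × Λ)`-matrices. It is only used where each sum has finitely many nonzero
terms. -/
noncomputable def mul (a b : Matrix Λ Λ R) : Matrix Λ Λ R :=
  fun i j => ∑ᶠ k, a i k * b k j

/-- The `(t × t)`-submatrix, for a finite set `t` of indices. -/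
def restrict (a : Matrix Λ Λ R) (t : Finset Λ) : Matrix t t R :=
  a.submatrix Subtype.val Subtype.val

/-- `a` is nonsingular: its submatrices on all sufficiently large finite convex sets are
invertible. -/
def IsNonsingular [DecidableEq Λ] (r : Λ → Λ → Prop) (a : Matrix Λ Λ R) : Prop :=
  ∃ t₀ : Finset Λ, IsConvex r (t₀ : Set Λ) ∧
    ∀ t : Finset Λ, IsConvex r (t : Set Λ) → t₀ ⊆ t → IsUnit (restrict a t)

def IsUpperTriangular (r : Λ → Λ → Prop) (a : Matrix Λ Λ R) : Prop :=
  ∀ i j, ¬ r i j → a i j = 0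

def IsAlmostUpperTriangular (r : Λ → Λ → Prop) (a : Matrix Λ Λ R) : Prop :=
  {p : Λ × Λ | ¬ r p.1 p.2 ∧ a p.1 p.2 ≠ 0}.Finite

/-- `U_Λ(R)`: the nonsingular upper triangular matrices. -/
def U [DecidableEq Λ] (r : Λ → Λ → Prop) (R : Type*) [CommRing R] : Type _ :=
  {a : Matrix Λ Λ R // IsUpperTriangular r a ∧ IsNonsingular r a}

/-- `AU_Λ(R)`: the nonsingular almost upper triangular matrices. -/
def AU [DecidableEq Λ] (r : Λ → Λ → Prop) (R : Type*) [CommRing R] : Type _ :=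
  {a : Matrix Λ Λ R // IsAlmostUpperTriangular r a ∧ IsNonsingular r a}

section Products

variable {r : Λ → Λ → Prop} [IsZLike r]

theorem interval_finite (r : Λ → Λ → Prop) [IsZLike r] (i j : Λ) : {k | r i k ∧ r k j}.Finite := by
  classical
  obtain ⟨t, ht, hc⟩ := exists_convex r ({i, j} : Finset Λ)
  refine t.finite_toSet.subset fun k hk => hc i (ht (by simp)) j (ht (by simp)) k hk.1 hk.2


theorem mul_term_eq_zero {a b : Matrix Λ Λ R} (ha : IsUpperTriangular r a)
    (hb : IsUpperTriangular r b) (i j k : Λ) (h : ¬ (r i k ∧ r k j)) : a i k * b k j = 0 := by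
  by_cases h1 : r i k
  · rw [hb k j fun h2 => h ⟨h1, h2⟩, mul_zero]
  · rw [ha i k h1, zero_mul]

theorem mul_upper {a b : Matrix Λ Λ R} (ha : IsUpperTriangular r a)
    (hb : IsUpperTriangular r b) : IsUpperTriangular r (mul a b) := by
  intro i j hij
  refine finsum_eq_zero_of_forall_eq_zero fun k => mul_term_eq_zero ha hb i j k ?_
  exact fun h => hij (trans_of r h.1 h.2)

theorem restrict_mul {a b : Matrix Λ Λ R} (ha : IsUpperTriangular r a)
    (hb : IsUpperTriangular r b) {t : Finset Λ} (ht : IsConvex r (t : Set Λ)) :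
    restrict (mul a b) t = restrict a t * restrict b t := by
  ext i j
  simp only [restrict, Matrix.submatrix_apply, Matrix.mul_apply, mul]
  rw [finsum_eq_sum_of_support_subset (s := t)]
  · exact (Finset.sum_coe_sort t fun k => a i k * b k j).symm
  · intro k hk
    by_contra hkt
    exact hk (mul_term_eq_zero ha hb i j k fun h => hkt (ht i i.2 j j.2 k h.1 h.2))

variable (r) in
theorem eq_of_restrict {a b : Matrix Λ Λ R} (t₀ : Finset Λ)
    (h : ∀ t : Finset Λ, IsConvex r (t : Set Λ) → t₀ ⊆ t → restrict a t = restrict b t) :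
    a = b := by
  classical
  ext i j
  obtain ⟨t, ht, hc⟩ := exists_convex r (t₀ ∪ {i, j})
  have := congrFun (congrFun (h t hc (Finset.union_subset_left ht)) ⟨i, ht (by simp)⟩)
    ⟨j, ht (by simp)⟩
  exact this

theorem mul_assoc_upper {a b c : Matrix Λ Λ R} (ha : IsUpperTriangular r a)
    (hb : IsUpperTriangular r b) (hc : IsUpperTriangular r c) :
    mul (mul a b) c = mul a (mul b c) :=
  eq_of_restrict r ∅ fun t ht _ => by
    rw [restrict_mul (mul_upper ha hb) hc ht, restrict_mul ha hb ht,
      restrict_mul ha (mul_upper hb hc) ht, restrict_mul hb hc ht, mul_assoc]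

variable [DecidableEq Λ]

theorem restrict_one (t : Finset Λ) : restrict (1 : Matrix Λ Λ R) t = 1 := by
  exact Matrix.submatrix_one _ Subtype.val_injective

theorem one_mul' (a : Matrix Λ Λ R) : mul 1 a = a := by
  ext i j
  rw [mul, finsum_eq_single _ i]
  · simp
  · intro k hk
    simp [Matrix.one_apply_ne hk.symm]

theorem mul_one' (a : Matrix Λ Λ R) : mul a 1 = a := by
  ext i j
  rw [mul, finsum_eq_single _ j]
  · simp
  · intro k hk
    simp [Matrix.one_apply_ne hk]

theorem one_upper : IsUpperTriangular r (1 : Matrix Λ Λ R) := by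
  intro i j h
  refine Matrix.one_apply_ne ?_
  rintro rfl
  exact h (refl_of r i)

variable (r) in
theorem one_nonsingular : IsNonsingular r (1 : Matrix Λ Λ R) :=
  ⟨∅, by intro i hi; simp at hi, fun t _ _ => by rw [restrict_one]; exact isUnit_one⟩

theorem mul_nonsingular {a b : Matrix Λ Λ R} (ha : IsUpperTriangular r a)
    (hb : IsUpperTriangular r b) (ha' : IsNonsingular r a) (hb' : IsNonsingular r b) :
    IsNonsingular r (mul a b) := by
  obtain ⟨s, -, hs⟩ := ha'
  obtain ⟨t, -, ht⟩ := hb'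
  obtain ⟨u, hu, hc⟩ := exists_convex r (s ∪ t)
  refine ⟨u, hc, fun v hv huv => ?_⟩
  rw [restrict_mul ha hb hv]
  exact (hs v hv ((Finset.union_subset_left hu).trans huv)).mul
    (ht v hv ((Finset.union_subset_right hu).trans huv))

/-- The inverse of a finite invertible upper triangular matrix is upper triangular. -/
theorem inv_upper_finite {ι : Type*} [Fintype ι] [DecidableEq ι] (q : ι → ι → Prop)
    (hrefl : ∀ i, q i i) (htrans : ∀ i j k, q i j → q j k → q i k)
    (A : Matrix ι ι R) (hA : IsUpperTriangular q A) (hu : IsUnit A) :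
    IsUpperTriangular q A⁻¹ := by
  have hpow : ∀ n : ℕ, IsUpperTriangular q (A ^ n) := by
    intro n
    induction n with
    | zero =>
      intro i j h
      rw [pow_zero]
      refine Matrix.one_apply_ne ?_
      rintro rfl
      exact h (hrefl i)
    | succ n ih =>
      intro i j h
      rw [pow_succ, Matrix.mul_apply]
      refine Finset.sum_eq_zero fun k _ => ?_
      by_cases h1 : q i k
      · rw [hA k j fun h2 => h (htrans _ _ _ h1 h2), mul_zero]
      · rw [ih i k h1, zero_mul]
  have haeval : ∀ p : Polynomial R, IsUpperTriangular q (Polynomial.aeval A p) := by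
    intro p i j h
    rw [Polynomial.aeval_eq_sum_range, Matrix.sum_apply]
    refine Finset.sum_eq_zero fun n _ => ?_
    rw [Matrix.smul_apply, hpow n i j h, smul_zero]
  have hch := Matrix.aeval_self_charpoly A
  rw [← Polynomial.divX_mul_X_add A.charpoly, map_add, map_mul, Polynomial.aeval_X,
    Polynomial.aeval_C] at hch
  have hdet : IsUnit (A.charpoly.coeff 0) := by
    have h1 := (Matrix.isUnit_iff_isUnit_det A).1 hu
    rw [Matrix.det_eq_sign_charpoly_coeff] at h1
    exact isUnit_of_mul_isUnit_right h1
  obtain ⟨c, hc⟩ := hdet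
  have hinv : A⁻¹ = (-(↑c⁻¹ : R)) • Polynomial.aeval A A.charpoly.divX := by
    refine Matrix.inv_eq_left_inv ?_
    rw [smul_mul_assoc, eq_neg_of_add_eq_zero_left hch, ← hc, Algebra.algebraMap_eq_smul_one,
      smul_neg, neg_smul, neg_neg, smul_smul, Units.inv_mul, one_smul]
  intro i j h
  rw [hinv, Matrix.smul_apply, haeval _ i j h, smul_zero]

theorem exists_inverse {a : Matrix Λ Λ R} (ha : IsUpperTriangular r a)
    (ha' : IsNonsingular r a) :
    ∃ b : Matrix Λ Λ R, IsUpperTriangular r b ∧ IsNonsingular r b ∧ mul a b = 1 ∧ mul b a = 1 := by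
  obtain ⟨t₀, -, h₀⟩ := ha'
  let B : Finset Λ → Matrix Λ Λ R := fun t i j =>
    if h : i ∈ t ∧ j ∈ t then (restrict a t)⁻¹ ⟨i, h.1⟩ ⟨j, h.2⟩ else 0
  have hBr : ∀ t, restrict (B t) t = (restrict a t)⁻¹ := by
    intro t
    ext i j
    exact dif_pos ⟨i.2, j.2⟩
  have hBu : ∀ t : Finset Λ, IsConvex r (t : Set Λ) → t₀ ⊆ t → IsUpperTriangular r (B t) := by
    intro t ht h0 i j hij
    by_cases h : i ∈ t ∧ j ∈ t
    · simp only [B, dif_pos h]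
      refine inv_upper_finite (fun x y : t => r x y) (fun x => refl_of r _)
        (fun x y z hxy hyz => trans_of r hxy hyz) (restrict a t) (fun x y hxy => ha x y hxy)
        (h₀ t ht h0) ⟨i, h.1⟩ ⟨j, h.2⟩ hij
    · simp only [B, dif_neg h]
  have hcons : ∀ s t : Finset Λ, IsConvex r (s : Set Λ) → IsConvex r (t : Set Λ) → t₀ ⊆ s → s ⊆ t →
      restrict (B t) s = (restrict a s)⁻¹ := by
    intro s t hs ht h0 hst
    refine (Matrix.inv_eq_right_inv ?_).symm
    rw [← restrict_mul ha (hBu t ht (h0.trans hst)) hs]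
    have h1 : restrict (mul a (B t)) t = 1 := by
      rw [restrict_mul ha (hBu t ht (h0.trans hst)) ht, hBr]
      exact Matrix.mul_nonsing_inv _
        ((Matrix.isUnit_iff_isUnit_det _).1 (h₀ t ht (h0.trans hst)))
    ext i j
    have h2 := congrFun (congrFun h1 ⟨i, hst i.2⟩) ⟨j, hst j.2⟩
    rw [← restrict_one] at h2 ⊢
    exact h2
  choose T hT hTc using fun s : Finset Λ => exists_convex r (t₀ ∪ s)
  have hT0 : ∀ s, t₀ ⊆ T s := fun s => Finset.union_subset_left (hT s)
  have hTs : ∀ s, s ⊆ T s := fun s => Finset.union_subset_right (hT s)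
  let b : Matrix Λ Λ R := fun i j => B (T {i, j}) i j
  have hbu : IsUpperTriangular r b := fun i j hij => hBu _ (hTc _) (hT0 _) i j hij
  have hb : ∀ t : Finset Λ, IsConvex r (t : Set Λ) → t₀ ⊆ t →
      restrict b t = (restrict a t)⁻¹ := by
    intro t ht h0
    ext i j
    let s : Finset Λ := T {i.1, j.1}
    let u : Finset Λ := T (s ∪ t)
    have hsu : s ⊆ u := Finset.union_subset_left (hTs (s ∪ t))
    have htu : t ⊆ u := Finset.union_subset_right (hTs (s ∪ t))
    have hi : i.1 ∈ s := hTs _ (by simp)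
    have hj : j.1 ∈ s := hTs _ (by simp)
    have e1 := hcons s u (hTc _) (hTc _) (hT0 _) hsu
    have e2 := hcons t u ht (hTc _) h0 htu
    rw [← hBr s] at e1
    have e1' : B u i.1 j.1 = B s i.1 j.1 := congrFun (congrFun e1 ⟨i.1, hi⟩) ⟨j.1, hj⟩
    have e2' : B u i.1 j.1 = (restrict a t)⁻¹ i j := congrFun (congrFun e2 i) j
    exact e1'.symm.trans e2'
  have hd : ∀ t : Finset Λ, IsConvex r (t : Set Λ) → t₀ ⊆ t → IsUnit (restrict a t).det :=
    fun t ht h0 => (Matrix.isUnit_iff_isUnit_det _).1 (h₀ t ht h0)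
  refine ⟨b, hbu, ⟨T ∅, hTc _, fun t ht h0 => ?_⟩, ?_, ?_⟩
  · rw [hb t ht ((hT0 _).trans h0)]
    exact Matrix.isUnit_nonsing_inv_iff.2 (h₀ t ht ((hT0 _).trans h0))
  · refine eq_of_restrict r t₀ fun t ht h0 => ?_
    rw [restrict_mul ha hbu ht, hb t ht h0, restrict_one, Matrix.mul_nonsing_inv _ (hd t ht h0)]
  · refine eq_of_restrict r t₀ fun t ht h0 => ?_
    rw [restrict_mul hbu ha ht, hb t ht h0, restrict_one, Matrix.nonsing_inv_mul _ (hd t ht h0)]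

/-- `U_{Λ+Λ'}(R) ⊆ AU_Λ(R)`. -/
theorem almostUpper_of_adjoin {a : Matrix Λ Λ R} (s : Finset Λ)
    (ha : IsUpperTriangular (adjoin r (s : Set Λ)) a)
    (ha' : IsNonsingular (adjoin r (s : Set Λ)) a) :
    IsAlmostUpperTriangular r a ∧ IsNonsingular r a := by
  constructor
  · obtain ⟨t, ht, hc⟩ := IsZLike.exists_stronglyConvex (r := r) s
    refine (t ×ˢ t).finite_toSet.subset ?_
    rintro ⟨i, j⟩ ⟨hij, hne⟩
    have h : adjoin r (s : Set Λ) i j := by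
      by_contra h
      exact hne (ha i j h)
    rcases (adjoin_iff r _ _ _).1 h with h | ⟨x, hx, y, hy, h1, h2⟩
    · exact absurd h hij
    · simp only [Finset.coe_product, Set.mem_prod, Finset.mem_coe]
      constructor
      · by_contra hi
        rcases hc i hi with h | h
        · exact hij (trans_of r (h y (ht hy)).1 h2)
        · exact (h x (ht hx)).2 ⟨(h x (ht hx)).1, h1⟩
      · by_contra hj
        rcases hc j hj with h | h
        · exact (h y (ht hy)).2 ⟨(h y (ht hy)).1, h2⟩
        · exact hij (trans_of r h1 (h x (ht hx)).1)
  · obtain ⟨t₀, -, h₀⟩ := ha'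
    obtain ⟨u, hu, hc⟩ := exists_convex r (s ∪ t₀)
    refine ⟨u, hc, fun t ht hut => h₀ t ?_ ((Finset.union_subset_right hu).trans hut)⟩
    have hs : ∀ x ∈ s, x ∈ t := fun x hx => hut (hu (Finset.mem_union_left _ hx))
    intro i hi j hj k hik hkj
    rcases (adjoin_iff r _ _ _).1 hik with h | ⟨x, hx, y, hy, h1, h2⟩ <;>
      rcases (adjoin_iff r _ _ _).1 hkj with h' | ⟨x', hx', y', hy', h1', h2'⟩
    · exact ht i hi j hj k h h'
    · exact ht i hi x' (hs _ hx') k h h1'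
    · exact ht y (hs _ hy) j hj k h2 h'
    · exact ht y (hs _ hy) x' (hs _ hx') k h2 h1'

theorem upper_adjoin_mono {a : Matrix Λ Λ R} {s t : Finset Λ} (hst : s ⊆ t)
    (ha : IsUpperTriangular (adjoin r (s : Set Λ)) a) :
    IsUpperTriangular (adjoin r (t : Set Λ)) a := by
  intro i j h
  refine ha i j fun h' => h (Relation.ReflTransGen.mono (r := fun i j => r i j ∨ (i ∈ (s : Set Λ) ∧ j ∈ (s : Set Λ)))
    ?_ i j h')
  exact fun x y hxy => hxy.imp id fun h => ⟨hst h.1, hst h.2⟩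

theorem nonsingular_adjoin {a : Matrix Λ Λ R} (s : Finset Λ) (ha : IsNonsingular r a) :
    IsNonsingular (adjoin r (s : Set Λ)) a := by
  obtain ⟨t₀, -, h₀⟩ := ha
  have := adjoin_isZLike r s
  obtain ⟨u, hu, hc⟩ := exists_convex (adjoin r (s : Set Λ)) t₀
  refine ⟨u, hc, fun t ht hut => h₀ t ?_ (hu.trans hut)⟩
  intro i hi j hj k hik hkj
  exact ht i hi j hj k (.single (Or.inl hik)) (.single (Or.inl hkj))

theorem exists_upper_adjoin {a : Matrix Λ Λ R} (ha : IsAlmostUpperTriangular r a) :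
    ∃ s : Finset Λ, IsUpperTriangular (adjoin r (s : Set Λ)) a := by
  let v := ha.toFinset
  refine ⟨v.image Prod.fst ∪ v.image Prod.snd, fun i j h => ?_⟩
  by_contra hne
  have hij : ¬ r i j := fun h' => h (.single (Or.inl h'))
  have hv : (i, j) ∈ v := ha.mem_toFinset.2 ⟨hij, hne⟩
  refine h (.single (Or.inr ⟨?_, ?_⟩))
  · exact Finset.mem_union_left _ (Finset.mem_image.2 ⟨_, hv, rfl⟩)
  · exact Finset.mem_union_right _ (Finset.mem_image.2 ⟨_, hv, rfl⟩)

end Products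

section Groups

variable [DecidableEq Λ] (r : Λ → Λ → Prop) [IsZLike r]

/-- `U_Λ(R)` is a group under matrix multiplication. -/
noncomputable instance : Group (U r R) where
  mul a b := ⟨mul a.1 b.1, mul_upper a.2.1 b.2.1, mul_nonsingular a.2.1 b.2.1 a.2.2 b.2.2⟩
  one := ⟨1, one_upper, one_nonsingular r⟩
  inv a := ⟨(exists_inverse a.2.1 a.2.2).choose, (exists_inverse a.2.1 a.2.2).choose_spec.1,
    (exists_inverse a.2.1 a.2.2).choose_spec.2.1⟩
  mul_assoc a b c := Subtype.ext (mul_assoc_upper a.2.1 b.2.1 c.2.1)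
  one_mul a := Subtype.ext (one_mul' a.1)
  mul_one a := Subtype.ext (mul_one' a.1)
  inv_mul_cancel a := Subtype.ext (exists_inverse a.2.1 a.2.2).choose_spec.2.2.2

/-- The inclusion of `U_{Λ+Λ'}(R)` in `AU_Λ(R)`. -/
def inclusion (s : Finset Λ) (a : U (adjoin r (s : Set Λ)) R) : AU r R :=
  ⟨a.1, almostUpper_of_adjoin s a.2.1 a.2.2⟩

variable {r}

theorem AU.exists_common (a b c : AU r R) : ∃ s : Finset Λ,
    IsUpperTriangular (adjoin r (s : Set Λ)) a.1 ∧ IsUpperTriangular (adjoin r (s : Set Λ)) b.1 ∧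
    IsUpperTriangular (adjoin r (s : Set Λ)) c.1 := by
  obtain ⟨s, hs⟩ := exists_upper_adjoin a.2.1
  obtain ⟨t, ht⟩ := exists_upper_adjoin b.2.1
  obtain ⟨u, hu⟩ := exists_upper_adjoin c.2.1
  refine ⟨s ∪ t ∪ u, upper_adjoin_mono ?_ hs, upper_adjoin_mono ?_ ht, upper_adjoin_mono ?_ hu⟩
  · exact Finset.subset_union_left.trans Finset.subset_union_left
  · exact Finset.subset_union_right.trans Finset.subset_union_left
  · exact Finset.subset_union_right

theorem AU.mul_mem (a b : AU r R) :
    IsAlmostUpperTriangular r (mul a.1 b.1) ∧ IsNonsingular r (mul a.1 b.1) := by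
  obtain ⟨s, ha, hb, -⟩ := AU.exists_common a b a
  have := adjoin_isZLike r s
  exact almostUpper_of_adjoin s (mul_upper ha hb)
    (mul_nonsingular ha hb (nonsingular_adjoin s a.2.2) (nonsingular_adjoin s b.2.2))

theorem AU.mul_assoc' (a b c : AU r R) : mul (mul a.1 b.1) c.1 = mul a.1 (mul b.1 c.1) := by
  obtain ⟨s, ha, hb, hc⟩ := AU.exists_common a b c
  have := adjoin_isZLike r s
  exact mul_assoc_upper ha hb hc

theorem AU.one_mem : IsAlmostUpperTriangular r (1 : Matrix Λ Λ R) ∧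
    IsNonsingular r (1 : Matrix Λ Λ R) := by
  refine ⟨?_, one_nonsingular r⟩
  refine Set.finite_empty.subset fun p hp => ?_
  exact hp.2 (one_upper p.1 p.2 hp.1)

theorem AU.exists_inv (a : AU r R) : ∃ b : AU r R, mul b.1 a.1 = 1 := by
  obtain ⟨s, ha, -⟩ := AU.exists_common a a a
  have := adjoin_isZLike r s
  obtain ⟨b, hb, hb', -, h⟩ := exists_inverse ha (nonsingular_adjoin s a.2.2)
  exact ⟨⟨b, almostUpper_of_adjoin s hb hb'⟩, h⟩

/-- `AU_Λ(R)` is a group under matrix multiplication. -/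
noncomputable instance : Group (AU r R) where
  mul a b := ⟨mul a.1 b.1, AU.mul_mem a b⟩
  one := ⟨1, AU.one_mem⟩
  inv a := (AU.exists_inv a).choose
  mul_assoc a b c := Subtype.ext (AU.mul_assoc' a b c)
  one_mul a := Subtype.ext (one_mul' a.1)
  mul_one a := Subtype.ext (mul_one' a.1)
  inv_mul_cancel a := Subtype.ext (AU.exists_inv a).choose_spec

end Groups

section Topology

variable [DecidableEq Λ] (r : Λ → Λ → Prop) [TopologicalSpace R]

/-- The topology of entrywise convergence on `U_Λ(R)`. -/
instance : TopologicalSpace (U r R) :=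
  TopologicalSpace.induced Subtype.val inferInstance

/-- The direct limit topology on `AU_Λ(R) = lim U_{Λ+Λ'}(R)`, with `Λ'` ranging over the finite
convex sets: a set is open iff its intersection with each `U_{Λ+Λ'}(R)` is open there. For discrete
`R` it is the group topology for which all these inclusions are continuous and open. -/
instance [IsZLike r] : TopologicalSpace (AU r R) :=
  ⨆ s : {s : Finset Λ // IsConvex r (s : Set Λ)},
    TopologicalSpace.coinduced (inclusion r s.1) inferInstance

end Topology

end Matrices

section Partitions

/-- A partition of `ℤ` into finite intervals. -/
structure IntervalPartition where
  parts : Set (Set ℤ)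
  isPartition : Setoid.IsPartition parts
  isInterval : ∀ p ∈ parts, ∃ m n : ℤ, p = Set.Icc m n

namespace IntervalPartition

variable (Q : IntervalPartition)

/-- `m ≲_Q n` if `m < n` or `m, n` lie in a common part. -/
def rel (m n : ℤ) : Prop := m < n ∨ ∃ p ∈ Q.parts, m ∈ p ∧ n ∈ p

/-- The set of sizes of parts. -/
def sizes : Set ℕ := {n | ∃ p ∈ Q.parts, p.ncard = n}

variable {Q} in
theorem part_eq {p q : Set ℤ} (hp : p ∈ Q.parts) (hq : q ∈ Q.parts) {m : ℤ} (hmp : m ∈ p)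
    (hmq : m ∈ q) : p = q :=
  (Q.isPartition.2 m).unique ⟨hp, hmp⟩ ⟨hq, hmq⟩

instance : IsZLike Q.rel where
  refl m := by
    obtain ⟨p, ⟨hp, hm⟩, -⟩ := Q.isPartition.2 m
    exact Or.inr ⟨p, hp, hm, hm⟩
  trans := by
    rintro a b c (h | ⟨p, hp, ha, hb⟩) (h' | ⟨q, hq, hb', hc⟩)
    · exact Or.inl (h.trans h')
    · by_cases hac : a < c
      · exact Or.inl hac
      · obtain ⟨m, n, rfl⟩ := Q.isInterval q hq
        simp only [Set.mem_Icc] at hb' hc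
        exact Or.inr ⟨_, hq, ⟨by omega, by omega⟩, hc⟩
    · by_cases hac : a < c
      · exact Or.inl hac
      · obtain ⟨m, n, rfl⟩ := Q.isInterval p hp
        simp only [Set.mem_Icc] at ha hb
        exact Or.inr ⟨_, hp, ha, ⟨by omega, by omega⟩⟩
    · obtain rfl := part_eq hp hq hb hb'
      exact Or.inr ⟨_, hp, ha, hc⟩
  exists_stronglyConvex := by
    intro s
    obtain ⟨A, hA⟩ := s.bddBelow
    obtain ⟨B, hB⟩ := s.bddAbove
    obtain ⟨p, ⟨hp, hAp⟩, -⟩ := Q.isPartition.2 (min A B)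
    obtain ⟨q, ⟨hq, hBq⟩, -⟩ := Q.isPartition.2 (max A B)
    obtain ⟨m, m', rfl⟩ := Q.isInterval p hp
    obtain ⟨n', n, rfl⟩ := Q.isInterval q hq
    have hA' : m ≤ min A B := hAp.1
    have hB' : max A B ≤ n := hBq.2
    refine ⟨Finset.Icc m n, fun x hx => ?_, fun i hi => ?_⟩
    · have h1 : A ≤ x := hA hx
      have h2 : x ≤ B := hB hx
      exact Finset.mem_Icc.2 ⟨by omega, by omega⟩
    · simp only [Finset.coe_Icc, Set.mem_Icc] at hi ⊢
      by_cases him : i < m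
      · refine Or.inl fun j hj => ⟨Or.inl (by omega), ?_⟩
        rintro ⟨-, h | ⟨p', hp', hj', hi'⟩⟩
        · omega
        · obtain ⟨x, y, rfl⟩ := Q.isInterval p' hp'
          simp only [Set.mem_Icc] at hj' hi' hAp
          have e := part_eq hp hp' (m := m) ⟨by omega, by omega⟩ ⟨by omega, by omega⟩
          have hx : i ∈ Set.Icc m m' := e ▸ ⟨by omega, by omega⟩
          exact absurd hx.1 (by omega)
      · refine Or.inr fun j hj => ⟨Or.inl (by omega), ?_⟩
        rintro ⟨-, h | ⟨p', hp', hi', hj'⟩⟩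
        · omega
        · obtain ⟨x, y, rfl⟩ := Q.isInterval p' hp'
          simp only [Set.mem_Icc] at hj' hi' hBq
          have e := part_eq hq hp' (m := n) ⟨by omega, by omega⟩ ⟨by omega, by omega⟩
          have hx : i ∈ Set.Icc n' n := e ▸ ⟨by omega, by omega⟩
          exact absurd hx.2 (by omega)

end IntervalPartition

end Partitions

/-- The quotient topology on `PGL(n, R)`; it is discrete if `R` is. -/
instance {n R : Type*} [Fintype n] [DecidableEq n] [CommRing R] [TopologicalSpace R] :
    TopologicalSpace (Matrix.ProjGenLinGroup n R) :=
  TopologicalSpace.coinduced Matrix.ProjGenLinGroup.mk inferInstance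

/-- `G` and `H` are locally isomorphic: there is an open embedding into `H` of an open neighbourhood
of the identity in `G` that is compatible with the group operations as far as they are defined. -/
def LocallyIsomorphic (G H : Type*) [Group G] [TopologicalSpace G] [Group H] [TopologicalSpace H] :
    Prop :=
  ∃ (V : Set G) (φ : V → H), IsOpen V ∧ (1 : G) ∈ V ∧ Topology.IsOpenEmbedding φ ∧
    (∀ (x y : V) (h : (x * y : G) ∈ V), φ ⟨x * y, h⟩ = φ x * φ y) ∧
    (∀ (x : V) (h : (x⁻¹ : G) ∈ V), φ ⟨(x : G)⁻¹, h⟩ = (φ x)⁻¹)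

end InfMatrix

/-!
A diagonal block of size `n` maps `U` onto `PGL_n`. Conversely, let `ψ` be a continuous homomorphism
of an open subgroup `L` of `U` onto `PGL_n`, where `L` contains all matrices that are trivial on a
finite convex set `C`; let `K` be the group of these. By continuity `ψ` only depends on a finite
window, in which the matrices with trivial diagonal blocks have `p`-power order, `p = char F`. So
modulo a normal subgroup `P` of `p`-power torsion, `ψ(K)` is generated by the images of the groups
`GL_m` of the blocks outside `C`; these commute with each other, and each of them is normal.

If `m > n` and `m ≥ 3`, then `GL_m` is too large to embed into `PGL_n` modulo its centre, so the map
kills all transvections and has abelian image. If `m < n` and `n ≥ 3`, then `P = 1` and the image of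
`GL_m` is a normal subgroup of `PGL_n` that is too small to contain the transvections, hence it is
trivial. If `m = 1`, then `GL_m` is abelian. So if no block has size `n`, the commutators in `ψ(K)`
have `p`-power order. But the commutator of the transvections `1 + s E_ij` and `1 + E_ji` acts on a
plane with determinant `1` and trace `2 + s²`, so it has `p`-power order modulo scalars only if
`(2 + s²)² = 4`, which fails for some `s`. Hence `ψ(K)` does not contain all transvections, which is
a contradiction if `K = U` and gives `ψ(K) = 1` if `n ≥ 3`.

In the latter case `ψ` factors through `GL_C`, so that `n ≤ |C|`. As `U` is open in `AU`, a local
isomorphism restricts to an open embedding of an open subgroup of one group `U` into the other, and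
composing it with the maps given by the large blocks of the second partition shows that almost all
sizes of these are sizes of blocks of the first one.
-/

namespace InfMatrix

open Matrix Topology
open scoped commutatorElement

section NormalSubgroups

variable {ι F : Type*} [Fintype ι] [DecidableEq ι] [Field F]

/-- The transvection `x ↦ x + (φ ⬝ᵥ x) • w`, for a linear form `φ` vanishing at `w`. -/
def transvectionGL {R : Type*} [CommRing R] (w φ : ι → R) (h : φ ⬝ᵥ w = 0) : GL ι R where
  val := 1 + vecMulVec w φ
  inv := 1 - vecMulVec w φ
  val_inv := by simp [add_mul, mul_sub, vecMulVec_mul_vecMulVec, h]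
  inv_val := by simp [sub_mul, mul_add, vecMulVec_mul_vecMulVec, h]

/-- The elementary transvection `t` as an element of the general linear group. -/
def elementaryGL {R : Type*} [CommRing R] (t : TransvectionStruct ι R) : GL ι R where
  val := t.toMatrix
  inv := t.inv.toMatrix
  val_inv := t.mul_inv
  inv_val := t.inv_mul

section Transvections

variable {R : Type*} [CommRing R] {w φ ψ : ι → R}

theorem coe_transvectionGL (h : φ ⬝ᵥ w = 0) :
    (transvectionGL w φ h : Matrix ι ι R) = 1 + vecMulVec w φ := rfl

theorem inv_transvectionGL (h : φ ⬝ᵥ w = 0) :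
    (transvectionGL w φ h)⁻¹ = transvectionGL w (-φ) (by rw [neg_dotProduct, h, neg_zero]) := by
  apply Units.ext
  change 1 - vecMulVec w φ = 1 + vecMulVec w (-φ)
  rw [vecMulVec_neg, sub_eq_add_neg]

theorem transvectionGL_mul (hφ : φ ⬝ᵥ w = 0) (hψ : ψ ⬝ᵥ w = 0) :
    transvectionGL w φ hφ * transvectionGL w ψ hψ =
      transvectionGL w (φ + ψ) (by rw [add_dotProduct, hφ, hψ, add_zero]) := by
  apply Units.ext
  simp only [Units.val_mul, coe_transvectionGL, add_mul, mul_add, one_mul, mul_one,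
    vecMulVec_mul_vecMulVec, hφ, zero_smul, vecMulVec_zero, add_zero, vecMulVec_add]
  abel

theorem elementaryGL_eq_transvectionGL (t : TransvectionStruct ι R) :
    elementaryGL t = transvectionGL (Pi.single t.i 1) (Pi.single t.j t.c)
      (by simp [t.hij.symm]) := by
  apply Units.ext
  change transvection t.i t.j t.c = 1 + vecMulVec (Pi.single t.i 1) (Pi.single t.j t.c)
  ext a b
  simp only [transvection, Matrix.add_apply, vecMulVec_apply, single_apply, Pi.single_apply]
  grind

theorem transvectionGL_mulVec (h : φ ⬝ᵥ w = 0) (x : ι → R) :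
    (transvectionGL w φ h).1 *ᵥ x = x + (φ ⬝ᵥ x) • w := by
  simp [coe_transvectionGL, add_mulVec, vecMulVec_mulVec]

theorem transvectionGL_conj (g : GL ι R) (h : φ ⬝ᵥ w = 0) :
    g * transvectionGL w φ h * g⁻¹ = transvectionGL (g.1 *ᵥ w) (φ ᵥ* (g⁻¹).1)
      (by rw [dotProduct_mulVec, vecMul_vecMul, Units.inv_mul, vecMul_one, h]) := by
  apply Units.ext
  simp only [Units.val_mul, coe_transvectionGL, mul_add, add_mul, mul_one, Units.mul_inv,
    mul_vecMulVec, vecMulVec_mul]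

theorem vecMul_inv_dotProduct_eq_zero {g : GL ι R} (hg : g.1 *ᵥ w = w) (h : φ ⬝ᵥ w = 0) :
    φ ᵥ* (g⁻¹).1 ⬝ᵥ w = 0 := by
  rw [← h, ← dotProduct_mulVec]
  nth_rewrite 1 [← hg]
  rw [mulVec_mulVec, Units.inv_mul, one_mulVec]

theorem commutator_transvectionGL {g : GL ι R} (hg : g.1 *ᵥ w = w) (h : φ ⬝ᵥ w = 0) :
    ⁅g, transvectionGL w φ h⁆ = transvectionGL w (φ ᵥ* (g⁻¹).1 - φ)
      (by rw [sub_dotProduct, vecMul_inv_dotProduct_eq_zero hg h, h, sub_zero]) := by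
  simp only [commutatorElement_def, transvectionGL_conj, hg, inv_transvectionGL,
    transvectionGL_mul, sub_eq_add_neg]

/-- The invertible diagonal matrices, as a homomorphism into the general linear group. -/
def diagonalGL : (ι → Rˣ) →* GL ι R where
  toFun d :=
    { val := diagonal fun i => (d i : R)
      inv := diagonal fun i => ((d i)⁻¹ : Rˣ)
      val_inv := by simp
      inv_val := by simp }
  map_one' := Units.ext (by simp)
  map_mul' d e := Units.ext (by simp)

end Transvections

omit [DecidableEq ι] in
theorem exists_dotProduct_ne_zero {v w : ι → F} (hv : v ≠ 0) (hw : w ≠ 0) :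
    ∃ φ : ι → F, φ ⬝ᵥ v ≠ 0 ∧ φ ⬝ᵥ w ≠ 0 := by
  classical
  obtain ⟨i, hi⟩ := Function.ne_iff.1 hv
  obtain ⟨j, hj⟩ := Function.ne_iff.1 hw
  by_cases hwi : w i = 0
  · by_cases hvj : v j = 0
    · refine ⟨Pi.single i 1 + Pi.single j 1, ?_, ?_⟩ <;> simp_all
    · exact ⟨Pi.single j 1, by simpa using hvj, by simpa using hj⟩
  · exact ⟨Pi.single i 1, by simpa using hi, by simpa using hwi⟩

theorem exists_GL_mulVec_eq {v w : ι → F} (hv : v ≠ 0) (hw : w ≠ 0) :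
    ∃ g : GL ι F, g.1 *ᵥ v = w := by
  obtain ⟨φ, hφv, hφw⟩ := exists_dotProduct_ne_zero hv hw
  let A : Matrix ι ι F := 1 + vecMulVec ((φ ⬝ᵥ v)⁻¹ • (w - v)) φ
  have hA : A.det ≠ 0 := by
    have : A.det = (φ ⬝ᵥ v)⁻¹ * (φ ⬝ᵥ w) := by
      simp only [A, vecMulVec_eq Unit, det_one_add_replicateCol_mul_replicateRow, dotProduct_smul,
        dotProduct_sub, smul_eq_mul]
      field_simp
      ring
    rw [this]
    exact mul_ne_zero (inv_ne_zero hφv) hφw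
  refine ⟨GeneralLinearGroup.mkOfDetNeZero A hA, ?_⟩
  change A *ᵥ v = w
  rw [add_mulVec, one_mulVec, vecMulVec_mulVec, op_smul_eq_smul, smul_smul, mul_inv_cancel₀ hφv,
    one_smul, add_sub_cancel]

theorem exists_eq_one_add_vecMulVec {A : Matrix ι ι F} {w : ι → F} (hw : w ≠ 0)
    (hA : ∀ e : ι → F, e ⬝ᵥ w = 0 → e ᵥ* A = e) : ∃ φ : ι → F, A = 1 + vecMulVec w φ := by
  obtain ⟨k, hk⟩ : ∃ k, w k ≠ 0 := Function.ne_iff.1 hw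
  refine ⟨(w k)⁻¹ • (A - 1) k, ?_⟩
  ext a b
  have hab := congrFun (hA (Pi.single a (w k) - Pi.single k (w a)) (by simp [mul_comm])) b
  simp only [sub_vecMul, Pi.sub_apply, single_vecMul, Pi.smul_apply, row_apply, smul_eq_mul] at hab
  simp only [Matrix.add_apply, vecMulVec_apply, Pi.smul_apply, Matrix.sub_apply, smul_eq_mul,
    one_apply] at hab ⊢
  field_simp
  simp only [Pi.single_apply, eq_comm (a := b)] at hab
  grind

omit [DecidableEq ι] in
theorem exists_ne_zero_dotProduct_eq_zero (hι : 2 < Fintype.card ι) (φ ψ : ι → F) :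
    ∃ w : ι → F, w ≠ 0 ∧ φ ⬝ᵥ w = 0 ∧ ψ ⬝ᵥ w = 0 := by
  have hker := LinearMap.ker_ne_bot_of_finrank_lt (f := (Matrix.of ![φ, ψ]).mulVecLin) (by simpa)
  obtain ⟨w, hw, hw0⟩ := (Submodule.ne_bot_iff _).1 hker
  exact ⟨w, hw0, congrFun (LinearMap.mem_ker.1 hw) 0, congrFun (LinearMap.mem_ker.1 hw) 1⟩

variable {K : Subgroup (GL ι F)} [hK : K.Normal]
include hK

theorem elementaryGL_mem_of_apply_ne_zero {t : TransvectionStruct ι F} {k : ι} (hk : k ≠ t.j)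
    {φ : ι → F} (h : φ ⬝ᵥ Pi.single t.i 1 = 0) (hφ : φ k ≠ 0)
    (hmem : transvectionGL (Pi.single t.i 1) φ h ∈ K) : elementaryGL t ∈ K := by
  let g := transvectionGL (Pi.single k (-(t.c / φ k))) (Pi.single t.j 1) (by simp [hk.symm])
  have hg : g.1 *ᵥ Pi.single t.i 1 = Pi.single t.i 1 := by
    rw [transvectionGL_mulVec]
    simp [t.hij.symm]
  have hcomm : ⁅g, transvectionGL (Pi.single t.i 1) φ h⁆ = elementaryGL t := by
    have : φ ᵥ* (g⁻¹).1 - φ = Pi.single t.j t.c := by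
      rw [inv_transvectionGL, coe_transvectionGL, vecMul_add, vecMul_one, vecMul_vecMulVec]
      simp [← Pi.single_smul, mul_div_cancel₀, hφ]
    simp only [commutator_transvectionGL hg, elementaryGL_eq_transvectionGL, this]
  rw [← hcomm]
  exact Subgroup.commutator_le_right ⊤ K
    (Subgroup.commutator_mem_commutator (Subgroup.mem_top g) hmem)

/-- In dimension at least three there is a third basis vector, through which a commutator reaches
the elementary transvections that a single commutator misses. -/
theorem elementaryGL_mem_of_transvectionGL_mem (hι : 2 < Fintype.card ι) {w φ : ι → F}
    (h : φ ⬝ᵥ w = 0) (hw : w ≠ 0) (hφ : φ ≠ 0) (hmem : transvectionGL w φ h ∈ K)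
    (t : TransvectionStruct ι F) : elementaryGL t ∈ K := by
  obtain ⟨g, hg⟩ : ∃ g : GL ι F, g.1 *ᵥ w = Pi.single t.i 1 := exists_GL_mulVec_eq hw (by simp)
  have hconj := hK.conj_mem _ hmem g
  simp only [transvectionGL_conj, hg] at hconj
  have hne : φ ᵥ* (g⁻¹).1 ≠ 0 := fun h0 => hφ <| by
    simpa [vecMul_vecMul] using congrArg (· ᵥ* g.1) h0
  obtain ⟨k, hk⟩ := Function.ne_iff.1 hne
  by_cases hkj : k = t.j
  · obtain ⟨l, hli, hlj⟩ := ENat.exists_ne_ne_of_three_le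
      (by rw [ENat.card_eq_coe_fintype_card]; exact_mod_cast hι) t.i t.j
    let s : TransvectionStruct ι F := ⟨t.i, l, hli.symm, 1⟩
    have hs : elementaryGL s ∈ K :=
      elementaryGL_mem_of_apply_ne_zero (k := k) (by rw [hkj]; exact hlj.symm) _ hk hconj
    rw [elementaryGL_eq_transvectionGL] at hs
    exact elementaryGL_mem_of_apply_ne_zero hlj _ (by simp [s]) hs
  · exact elementaryGL_mem_of_apply_ne_zero hkj _ hk hconj

theorem elementaryGL_mem_of_mulVec_eq (hι : 2 < Fintype.card ι) {g : GL ι F} (hg : g ∈ K)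
    (hg1 : g ≠ 1) {w : ι → F} (hw : w ≠ 0) (hgw : g.1 *ᵥ w = w) (t : TransvectionStruct ι F) :
    elementaryGL t ∈ K := by
  by_cases hfix : ∀ e : ι → F, e ⬝ᵥ w = 0 → e ᵥ* (g⁻¹).1 = e
  · obtain ⟨φ, hφ⟩ := exists_eq_one_add_vecMulVec (A := (g⁻¹).1) hw hfix
    have hφw : φ ⬝ᵥ w = 0 := by
      have : (g⁻¹).1 *ᵥ w = w := by
        nth_rewrite 1 [← hgw]
        rw [mulVec_mulVec, Units.inv_mul, one_mulVec]
      simpa [hφ, add_mulVec, vecMulVec_mulVec, hw] using this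
    have hginv : g⁻¹ = transvectionGL w φ hφw := Units.ext hφ
    refine elementaryGL_mem_of_transvectionGL_mem hι hφw hw ?_ (hginv ▸ inv_mem hg) t
    rintro rfl
    exact hg1 (inv_eq_one.1 (Units.ext (by simpa using hφ)))
  · push Not at hfix
    obtain ⟨e, he, hne⟩ := hfix
    have hcomm := Subgroup.commutator_le_left K ⊤
      (Subgroup.commutator_mem_commutator hg (Subgroup.mem_top (transvectionGL w e he)))
    rw [commutator_transvectionGL hgw] at hcomm
    exact elementaryGL_mem_of_transvectionGL_mem hι _ hw (sub_ne_zero.2 hne) hcomm t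

/-- The commutator of `g ∈ K` with a transvection `s` is a product of two transvections, so in
dimension at least three it fixes a nonzero vector. -/
theorem elementaryGL_mem_of_not_le_center (hι : 2 < Fintype.card ι)
    (hcenter : ¬ K ≤ Subgroup.center (GL ι F)) (t : TransvectionStruct ι F) :
    elementaryGL t ∈ K := by
  obtain ⟨g, hgK, hg⟩ := SetLike.not_le_iff_exists.1 hcenter
  obtain ⟨s, hs⟩ : ∃ s : TransvectionStruct ι F, ¬ Commute s.toMatrix g.1 := by
    by_contra! hcomm
    exact hg (GeneralLinearGroup.mem_center_iff_val_mem_range_scalar.2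
      (mem_range_scalar_of_commute_transvectionStruct hcomm))
  obtain ⟨w, hw, hsw, hgsw⟩ := exists_ne_zero_dotProduct_eq_zero hι (Pi.single s.j s.c)
    (Pi.single s.j s.c ᵥ* (g⁻¹).1)
  have hmem : ⁅g, elementaryGL s⁆ ∈ K := Subgroup.commutator_le_left K ⊤
    (Subgroup.commutator_mem_commutator hgK (Subgroup.mem_top _))
  refine elementaryGL_mem_of_mulVec_eq hι hmem ?_ hw ?_ t
  · rw [Ne, commutatorElement_eq_one_iff_commute]
    exact fun h => hs (congrArg Units.val h.eq).symm
  · simp only [commutatorElement_def, elementaryGL_eq_transvectionGL, transvectionGL_conj,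
      inv_transvectionGL, Units.val_mul, ← mulVec_mulVec, transvectionGL_mulVec, neg_dotProduct,
      hsw, hgsw, neg_zero, zero_smul, add_zero]

theorem mk'_comp_diagonalGL_surjective (h : ∀ t : TransvectionStruct ι F, elementaryGL t ∈ K) :
    Function.Surjective ((QuotientGroup.mk' K).comp diagonalGL) := by
  suffices ∀ g : GL ι F, QuotientGroup.mk' K g ∈ ((QuotientGroup.mk' K).comp diagonalGL).range from
    fun x => QuotientGroup.induction_on x this
  intro g
  refine diagonal_transvection_induction_of_det_ne_zero (fun A => ∀ u : GL ι F, u.1 = A →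
    QuotientGroup.mk' K u ∈ ((QuotientGroup.mk' K).comp diagonalGL).range) g.1
    (GeneralLinearGroup.det_ne_zero g) ?_ ?_ ?_ g rfl
  · intro D hD u hu
    rw [det_diagonal, Finset.prod_ne_zero_iff] at hD
    refine ⟨fun i => Units.mk0 (D i) (hD i (Finset.mem_univ i)), congrArg _ (Units.ext ?_)⟩
    exact hu.symm
  · intro t u hu
    obtain rfl : u = elementaryGL t := Units.ext hu
    have : QuotientGroup.mk' K (elementaryGL t) = 1 := (QuotientGroup.eq_one_iff _).2 (h t)
    exact this ▸ one_mem _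
  · intro A B hA hB ihA ihB u hu
    obtain rfl : u = .mkOfDetNeZero A hA * .mkOfDetNeZero B hB := Units.ext hu
    rw [map_mul]
    exact mul_mem (ihA _ rfl) (ihB _ rfl)

theorem commutator_mem_of_elementaryGL_mem (h : ∀ t : TransvectionStruct ι F, elementaryGL t ∈ K)
    (g₁ g₂ : GL ι F) : ⁅g₁, g₂⁆ ∈ K := by
  obtain ⟨d₁, h₁⟩ := mk'_comp_diagonalGL_surjective h (QuotientGroup.mk' K g₁)
  obtain ⟨d₂, h₂⟩ := mk'_comp_diagonalGL_surjective h (QuotientGroup.mk' K g₂)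
  rw [← QuotientGroup.eq_one_iff, ← QuotientGroup.mk'_apply, map_commutatorElement, ← h₁, ← h₂,
    commutatorElement_eq_one_iff_commute]
  exact (Commute.all d₁ d₂).map _

theorem card_GL_le_of_elementaryGL_mem [Finite F]
    (h : ∀ t : TransvectionStruct ι F, elementaryGL t ∈ K) :
    Nat.card (GL ι F) ≤ (Nat.card F - 1) ^ Fintype.card ι * Nat.card K := by
  have hcard : Nat.card (ι → Fˣ) = (Nat.card F - 1) ^ Fintype.card ι := by
    rw [Nat.card_pi, Finset.prod_const, Finset.card_univ, Nat.card_units]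
  rw [← hcard, ← Subgroup.card_mul_index K, mul_comm, Subgroup.index]
  gcongr
  exact Nat.card_le_card_of_surjective _ (mk'_comp_diagonalGL_surjective h)

end NormalSubgroups

section ProjectiveCommutators

variable {ι F : Type*} [Fintype ι] [DecidableEq ι] [Field F]

theorem trace_sq_eq_four_of_pow_eq_scalar (p : ℕ) [Fact p.Prime] [CharP F p]
    {M : Matrix (Fin 2) (Fin 2) F} (hM : M.det = 1) {k : ℕ} {c : F}
    (h : M ^ p ^ k = scalar (Fin 2) c) : M.trace ^ 2 = 4 := by
  have hc : c * c = 1 := by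
    have hdet := congrArg det h
    rwa [det_pow, hM, one_pow, scalar_apply, det_diagonal, Fin.prod_univ_two, eq_comm] at hdet
  have hcp : c ^ p ^ k = c := by
    rcases mul_self_eq_one_iff.1 hc with rfl | rfl
    · exact one_pow _
    · exact neg_one_pow_char_pow F p k
  have hdet : (M - scalar (Fin 2) c).det = 0 := by
    refine eq_zero_of_pow_eq_zero (n := p ^ k) ?_
    rw [← det_pow, sub_pow_char_pow_of_commute p k
      (scalar_commute c (fun _ => Commute.all _ _) M).symm, h, ← map_pow, hcp, sub_self,
      det_zero]
  have htrace : M.trace * c = 2 := by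
    simp only [det_fin_two, trace_fin_two, Matrix.sub_apply, scalar_apply, diagonal_apply_eq,
      diagonal_apply_ne _ zero_ne_one, diagonal_apply_ne _ one_ne_zero] at hM hdet ⊢
    linear_combination hM - hdet + hc
  linear_combination (M.trace * c + 2) * htrace - M.trace ^ 2 * hc

theorem coe_commutator_elementaryGL_fin_two {R : Type*} [CommRing R] (s : R) :
    ⁅elementaryGL ⟨(0 : Fin 2), 1, zero_ne_one, s⟩, elementaryGL ⟨1, 0, one_ne_zero, 1⟩⁆.1 =
      !![1 + s + s ^ 2, -s ^ 2; s, 1 - s] := by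
  have h01 (c : R) : transvection (0 : Fin 2) 1 c = !![1, c; 0, 1] := by
    rw [transvection, one_fin_two]
    ext a b
    fin_cases a <;> fin_cases b <;> simp
  have h10 (c : R) : transvection (1 : Fin 2) 0 c = !![1, 0; c, 1] := by
    rw [transvection, one_fin_two]
    ext a b
    fin_cases a <;> fin_cases b <;> simp
  change transvection 0 1 s * transvection 1 0 1 * transvection 0 1 (-s) *
    transvection 1 0 (-1) = _
  simp only [h01, h10, mul_fin_two]
  ring_nf

theorem transvection_mul_one_submatrix {κ R : Type*} [Fintype κ] [DecidableEq κ] [CommRing R]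
    {f : κ → ι} (hf : f.Injective) (a b : κ) (s : R) :
    transvection (f a) (f b) s * (1 : Matrix ι ι R).submatrix id f =
      (1 : Matrix ι ι R).submatrix id f * transvection a b s := by
  rw [transvection, transvection, Matrix.add_mul, Matrix.mul_add, Matrix.one_mul, Matrix.mul_one,
    add_right_inj]
  ext x y
  simp only [Matrix.mul_apply, single_apply, submatrix_apply, id, Matrix.one_apply]
  simp only [eq_comm, ite_and, mul_ite, ite_mul, mul_one, one_mul, mul_zero, zero_mul, hf.eq_iff,
    Finset.sum_ite_eq, Finset.sum_ite_eq', Finset.mem_univ, ↓reduceIte]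
  grind

/-- The two elementary transvections preserve the span of `e_i` and `e_j`, on which their commutator
has determinant `1` and trace `2 + s ^ 2`. -/
theorem add_sq_sq_eq_four_of_commutator_pow_eq_scalar (p : ℕ) [Fact p.Prime] [CharP F p] {i j : ι}
    (hij : i ≠ j) {s c : F} {k : ℕ}
    (h : ⁅elementaryGL (R := F) ⟨i, j, hij, s⟩, elementaryGL ⟨j, i, hij.symm, 1⟩⁆.1 ^ p ^ k =
      scalar ι c) : (2 + s ^ 2) ^ 2 = 4 := by
  have hf : Function.Injective ![i, j] := by
    simpa [Function.Injective, Fin.forall_fin_two] using ⟨hij, hij.symm⟩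
  let P := (1 : Matrix ι ι F).submatrix id ![i, j]
  let T : GL ι F := ⁅elementaryGL ⟨i, j, hij, s⟩, elementaryGL ⟨j, i, hij.symm, 1⟩⁆
  let T₀ : GL (Fin 2) F :=
    ⁅elementaryGL ⟨(0 : Fin 2), 1, zero_ne_one, s⟩, elementaryGL ⟨1, 0, one_ne_zero, 1⟩⁆
  have hmul {X Y : Matrix ι ι F} {X₀ Y₀ : Matrix (Fin 2) (Fin 2) F} (hX : X * P = P * X₀)
      (hY : Y * P = P * Y₀) : X * Y * P = P * (X₀ * Y₀) := by
    rw [Matrix.mul_assoc, hY, ← Matrix.mul_assoc, hX, Matrix.mul_assoc]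
  have hT : T.1 * P = P * T₀.1 :=
    have h01 (c : F) := transvection_mul_one_submatrix hf 0 1 c
    have h10 (c : F) := transvection_mul_one_submatrix hf 1 0 c
    hmul (hmul (hmul (h01 s) (h10 1)) (h01 (-s))) (h10 (-1))
  have hpow (m : ℕ) : T.1 ^ m * P = P * T₀.1 ^ m := by
    induction m with
    | zero => rw [pow_zero, pow_zero, Matrix.one_mul, Matrix.mul_one]
    | succ m ih => exact pow_succ T.1 m ▸ pow_succ T₀.1 m ▸ hmul ih hT
  have hPP : Pᵀ * P = 1 := by
    rw [transpose_submatrix, transpose_one, ← submatrix_mul _ _ _ _ _ Function.bijective_id,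
      Matrix.one_mul, submatrix_one _ hf]
  have hscalar : T₀.1 ^ p ^ k = scalar (Fin 2) c := by
    rw [← Matrix.one_mul (T₀.1 ^ _), ← hPP, Matrix.mul_assoc, ← hpow, h]
    simp [← smul_one_eq_diagonal, hPP]
  have hT₀ := coe_commutator_elementaryGL_fin_two s
  have hdet : T₀.1.det = 1 := by
    rw [hT₀, det_fin_two_of]
    ring
  have htrace : T₀.1.trace = 2 + s ^ 2 := by
    rw [hT₀, trace_fin_two_of]
    ring
  rw [← htrace]
  exact trace_sq_eq_four_of_pow_eq_scalar p hdet hscalar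

theorem exists_add_sq_sq_ne_four (F : Type*) [Field F] :
    ∃ s : F, (2 + s ^ 2) ^ 2 ≠ 4 := by
  by_cases h5 : (5 : F) = 0
  · refine ⟨2, fun h => one_ne_zero (α := F) ?_⟩
    linear_combination 13 * h5 - 2 * h
  · exact ⟨1, fun h => h5 (by linear_combination h)⟩

theorem exists_commutator_pow_ne_one (F : Type*) [Field F] (p : ℕ) [Fact p.Prime] [CharP F p]
    {i j : ι} (hij : i ≠ j) :
    ∃ s : F, ∀ k : ℕ, ⁅ProjGenLinGroup.mk (elementaryGL ⟨i, j, hij, s⟩),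
      ProjGenLinGroup.mk (elementaryGL ⟨j, i, hij.symm, (1 : F)⟩)⁆ ^ p ^ k ≠ 1 := by
  obtain ⟨s, hs⟩ := exists_add_sq_sq_ne_four F
  refine ⟨s, fun k h => hs ?_⟩
  rw [← map_commutatorElement, ← map_pow, ProjGenLinGroup.mk_eq_one,
    GeneralLinearGroup.mem_center_iff_val_mem_range_scalar] at h
  obtain ⟨c, hc⟩ := h
  exact add_sq_sq_eq_four_of_commutator_pow_eq_scalar p hij hc.symm

theorem mk_elementaryGL_mem_of_ne_bot (hι : 2 < Fintype.card ι)
    {H : Subgroup (ProjGenLinGroup ι F)} [hH : H.Normal] (hbot : H ≠ ⊥)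
    (t : TransvectionStruct ι F) : elementaryGL t ∈ H.comap ProjGenLinGroup.mk := by
  refine elementaryGL_mem_of_not_le_center hι (fun hle => hbot ?_) t
  rw [Subgroup.eq_bot_iff_forall]
  intro x hx
  obtain ⟨g, rfl⟩ := ProjGenLinGroup.mk_surjective x
  exact ProjGenLinGroup.mk_eq_one.2 (hle hx)

theorem eq_bot_of_commutator_pow_eq_one (p : ℕ) [Fact p.Prime] [CharP F p]
    (hι : 2 < Fintype.card ι) {H : Subgroup (ProjGenLinGroup ι F)} [H.Normal]
    (hH : ∀ x ∈ H, ∀ y ∈ H, ∃ k : ℕ, ⁅x, y⁆ ^ p ^ k = 1) : H = ⊥ := by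
  by_contra hbot
  obtain ⟨i, j, hij⟩ := Fintype.one_lt_card_iff.1 (one_lt_two.trans hι)
  obtain ⟨s, hs⟩ := exists_commutator_pow_ne_one F p hij
  obtain ⟨k, hk⟩ := hH _ (mk_elementaryGL_mem_of_ne_bot hι hbot ⟨i, j, hij, s⟩)
    _ (mk_elementaryGL_mem_of_ne_bot hι hbot ⟨j, i, hij.symm, 1⟩)
  exact hs k hk

end ProjectiveCommutators

section Cardinalities

variable {ι κ F : Type*} [Fintype ι] [DecidableEq ι] [Fintype κ] [DecidableEq κ] [Field F]
  [Finite F]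

theorem card_GL_fin_succ (n : ℕ) : Nat.card (GL (Fin (n + 1)) F) =
    Nat.card F ^ n * (Nat.card F ^ (n + 1) - 1) * Nat.card (GL (Fin n) F) := by
  have := Fintype.ofFinite F
  have hfactor (i : Fin n) : Fintype.card F ^ (n + 1) - Fintype.card F ^ (i.succ : ℕ) =
      Fintype.card F * (Fintype.card F ^ n - Fintype.card F ^ (i : ℕ)) := by
    rw [Nat.mul_sub, Fin.val_succ, pow_succ', pow_succ']
  rw [card_GL_field, card_GL_field, Fin.prod_univ_succ, Nat.card_eq_fintype_card]
  simp only [hfactor, Finset.prod_mul_distrib, Finset.prod_const, Finset.card_univ,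
    Fintype.card_fin, Fin.val_zero, pow_zero]
  ring

omit [Finite F] in
theorem card_GL_eq_card_GL_fin :
    Nat.card (GL ι F) = Nat.card (GL (Fin (Fintype.card ι)) F) :=
  Nat.card_congr (Units.mapEquiv
    (reindexAlgEquiv F F (Fintype.equivFin ι)).toRingEquiv.toMulEquiv).toEquiv

theorem monotone_card_GL_fin : Monotone fun n : ℕ => Nat.card (GL (Fin n) F) := by
  refine monotone_nat_of_le_succ fun n => ?_
  rw [card_GL_fin_succ]
  have hq : 1 < Nat.card F := Finite.one_lt_card
  have hpow : 1 < Nat.card F ^ (n + 1) := Nat.one_lt_pow n.succ_ne_zero hq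
  exact Nat.le_mul_of_pos_left _ (Nat.mul_pos (by positivity) (Nat.sub_pos_of_lt hpow))

theorem sub_one_pow_add_two_lt {q n : ℕ} (hq : 1 < q) (hn : n ≠ 0) :
    (q - 1) ^ (n + 2) < q ^ n * (q ^ (n + 1) - 1) := by
  obtain ⟨r, rfl⟩ : ∃ r, q = r + 1 := ⟨q - 1, by omega⟩
  rw [Nat.add_sub_cancel]
  have hgeom : r * (r + 1) ^ n ≤ (r + 1) ^ (n + 1) - 1 := by
    have : 1 ≤ (r + 1) ^ n := Nat.one_le_pow _ _ r.succ_pos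
    have : (r + 1) ^ (n + 1) = r * (r + 1) ^ n + (r + 1) ^ n := by ring
    omega
  calc r ^ (n + 2) = r * r ^ (n + 1) := by ring
    _ < r * (r + 1) ^ (n + 1) := by gcongr <;> omega
    _ ≤ r * (r + 1) ^ (n + n) := by gcongr <;> omega
    _ = (r + 1) ^ n * (r * (r + 1) ^ n) := by ring
    _ ≤ (r + 1) ^ n * ((r + 1) ^ (n + 1) - 1) := by gcongr

theorem card_GL_mul_pow_lt (hικ : Fintype.card ι < Fintype.card κ) (hκ : 1 < Fintype.card κ) :
    Nat.card (GL ι F) * (Nat.card F - 1) ^ (Fintype.card κ + 1) < Nat.card (GL κ F) := by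
  obtain ⟨k, hk⟩ : ∃ k, Fintype.card κ = k + 1 := ⟨Fintype.card κ - 1, by omega⟩
  rw [card_GL_eq_card_GL_fin (ι := ι), card_GL_eq_card_GL_fin (ι := κ), hk, card_GL_fin_succ,
    mul_comm]
  have hpos : 0 < Nat.card (GL (Fin k) F) := Nat.card_pos
  calc _ ≤ (Nat.card F - 1) ^ (k + 2) * Nat.card (GL (Fin k) F) := by
        gcongr
        exact monotone_card_GL_fin (by omega)
    _ < _ := by
        gcongr
        exact sub_one_pow_add_two_lt Finite.one_lt_card (by omega)

theorem card_center_GL_le : Nat.card (Subgroup.center (GL ι F)) ≤ Nat.card F - 1 := by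
  rw [GeneralLinearGroup.center_eq_range_scalar, ← Nat.card_units]
  exact Nat.card_le_card_of_surjective _ (GeneralLinearGroup.scalar ι).rangeRestrict_surjective

theorem card_comap_of_surjective {G H : Type*} [Group G] [Group H] [Finite G] {f : G →* H}
    (hf : Function.Surjective f) (K : Subgroup H) :
    Nat.card (K.comap f) = Nat.card K * Nat.card f.ker := by
  have : Finite H := Finite.of_surjective f hf
  refine Nat.eq_of_mul_eq_mul_right (Nat.pos_of_ne_zero K.index_ne_zero_of_finite) ?_
  calc Nat.card (K.comap f) * K.index = Nat.card (K.comap f) * (K.comap f).index := by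
        rw [Subgroup.index_comap_of_surjective _ hf]
    _ = Nat.card f.ker * f.ker.index := by simp only [Subgroup.card_mul_index]
    _ = Nat.card f.ker * Nat.card H := by
        rw [Subgroup.index_ker, f.range_eq_top_of_surjective hf, Subgroup.card_top]
    _ = Nat.card K * Nat.card f.ker * K.index := by rw [← K.card_mul_index]; ring

theorem card_GL_lt_card_of_ne_bot (hικ : Fintype.card ι < Fintype.card κ)
    (hκ : 2 < Fintype.card κ) {H : Subgroup (ProjGenLinGroup κ F)} [H.Normal] (hH : H ≠ ⊥) :
    Nat.card (GL ι F) < Nat.card H := by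
  refine lt_of_mul_lt_mul_right' (a := (Nat.card F - 1) ^ (Fintype.card κ + 1)) ?_
  calc Nat.card (GL ι F) * (Nat.card F - 1) ^ (Fintype.card κ + 1)
      < Nat.card (GL κ F) := card_GL_mul_pow_lt hικ (one_lt_two.trans hκ)
    _ ≤ (Nat.card F - 1) ^ Fintype.card κ * Nat.card (H.comap ProjGenLinGroup.mk) :=
        card_GL_le_of_elementaryGL_mem (mk_elementaryGL_mem_of_ne_bot hκ hH)
    _ ≤ (Nat.card F - 1) ^ Fintype.card κ * (Nat.card H * (Nat.card F - 1)) := by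
        rw [card_comap_of_surjective ProjGenLinGroup.mk_surjective, ProjGenLinGroup.ker_mk]
        gcongr
        exact card_center_GL_le
    _ = Nat.card H * (Nat.card F - 1) ^ (Fintype.card κ + 1) := by ring

end Cardinalities

section LinearQuotients

variable {ι κ F : Type*} [Fintype ι] [DecidableEq ι] [Fintype κ] [DecidableEq κ] [Field F]
  [Finite F]

theorem commute_map_of_card_lt (hκι : Fintype.card κ < Fintype.card ι) (hι : 2 < Fintype.card ι)
    (f : GL ι F →* ProjGenLinGroup κ F) (g h : GL ι F) : Commute (f g) (f h) := by
  have : Finite (ProjGenLinGroup κ F) := .of_surjective _ ProjGenLinGroup.mk_surjective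
  have hker : ¬ f.ker ≤ Subgroup.center (GL ι F) := by
    intro hle
    refine lt_irrefl (Nat.card (GL ι F)) ?_
    calc Nat.card (GL ι F) = Nat.card f.range * Nat.card f.ker := by
          rw [← f.ker.card_mul_index, Subgroup.index_ker, mul_comm]
      _ ≤ Nat.card (GL κ F) * (Nat.card F - 1) := by
          gcongr
          · exact f.range.card_le_card_group.trans
              (Nat.card_le_card_of_surjective _ ProjGenLinGroup.mk_surjective)
          · exact (Subgroup.card_le_of_le hle).trans card_center_GL_le
      _ ≤ Nat.card (GL κ F) * (Nat.card F - 1) ^ (Fintype.card ι + 1) := by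
          gcongr
          exact Nat.le_self_pow (Nat.succ_ne_zero _) _
      _ < Nat.card (GL ι F) := card_GL_mul_pow_lt hκι (one_lt_two.trans hι)
  rw [← commutatorElement_eq_one_iff_commute, ← map_commutatorElement, ← MonoidHom.mem_ker]
  exact commutator_mem_of_elementaryGL_mem (elementaryGL_mem_of_not_le_center hι hker) g h

theorem range_eq_bot_of_card_lt (hικ : Fintype.card ι < Fintype.card κ) (hκ : 2 < Fintype.card κ)
    (f : GL ι F →* ProjGenLinGroup κ F) [f.range.Normal] : f.range = ⊥ := by
  by_contra hbot
  exact (card_GL_lt_card_of_ne_bot hικ hκ hbot).not_ge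
    (Nat.card_le_card_of_surjective _ f.rangeRestrict_surjective)

omit [Finite F] in
theorem commute_GL_of_subsingleton [Subsingleton ι] (g h : GL ι F) : Commute g h := by
  refine Units.ext (Matrix.ext fun i j => ?_)
  have := uniqueOfSubsingleton i
  rw [Subsingleton.elim j i, Subsingleton.elim i default]
  simp [Matrix.mul_apply, mul_comm]

theorem commutator_map_mem_of_card_ne (p : ℕ) [Fact p.Prime] [CharP F p]
    (hne : Fintype.card ι ≠ Fintype.card κ) (hκ : 1 < Fintype.card κ)
    (f : GL ι F →* ProjGenLinGroup κ F) {P : Subgroup (ProjGenLinGroup κ F)} [P.Normal]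
    (hP : ∀ x ∈ P, ∃ k : ℕ, x ^ p ^ k = 1) [hf : (f.range ⊔ P).Normal] (g h : GL ι F) :
    ⁅f g, f h⁆ ∈ P := by
  rcases hne.lt_or_gt with hlt | hgt
  · by_cases hκ2 : 2 < Fintype.card κ
    · have hPbot : P = ⊥ := eq_bot_of_commutator_pow_eq_one p hκ2 fun x hx y hy =>
        hP _ (Subgroup.commutator_le_left P P (Subgroup.commutator_mem_commutator hx hy))
      rw [hPbot, sup_bot_eq] at hf
      have hfg : f g = 1 := by
        rw [← Subgroup.mem_bot, ← range_eq_bot_of_card_lt hlt hκ2 f]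
        exact ⟨g, rfl⟩
      rw [hfg, commutatorElement_one_left]
      exact one_mem P
    · have : Subsingleton ι := Fintype.card_le_one_iff_subsingleton.1 (by omega)
      rw [commutatorElement_eq_one_iff_commute.2 ((commute_GL_of_subsingleton g h).map f)]
      exact one_mem P
  · have hι : 2 < Fintype.card ι := by omega
    rw [commutatorElement_eq_one_iff_commute.2 (commute_map_of_card_lt hgt hι f g h)]
    exact one_mem P

end LinearQuotients

section SplitExtensions

variable {L I : Type*} [Group L]

theorem commutator_iSup_eq_bot {S : I → Subgroup L} (hS : ∀ i j, ⁅S i, S j⁆ = ⊥) :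
    ⁅⨆ i, S i, ⨆ i, S i⁆ = ⊥ := by
  simp only [Subgroup.commutator_eq_bot_iff_le_centralizer] at hS ⊢
  refine iSup_le fun i => Subgroup.le_centralizer_iff.1 (iSup_le fun j => ?_)
  exact hS j i

theorem commutator_le_of_le_sup_iSup {N K : Subgroup L} [N.Normal] {S : I → Subgroup L}
    (hS : ∀ i j, ⁅S i, S j⁆ ≤ N) (hK : K ≤ N ⊔ ⨆ i, S i) : ⁅K, K⁆ ≤ N := by
  have hcomm : ⁅⨆ i, (S i).map (QuotientGroup.mk' N), ⨆ i, (S i).map (QuotientGroup.mk' N)⁆ = ⊥ :=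
    commutator_iSup_eq_bot fun i j => by
      rw [← Subgroup.map_commutator, Subgroup.map_eq_bot_iff, QuotientGroup.ker_mk']
      exact hS i j
  have hKmap : K.map (QuotientGroup.mk' N) ≤ ⨆ i, (S i).map (QuotientGroup.mk' N) := by
    have h := Subgroup.map_mono (f := QuotientGroup.mk' N) hK
    rwa [Subgroup.map_sup, QuotientGroup.map_mk'_self, bot_sup_eq, Subgroup.map_iSup] at h
  rw [← QuotientGroup.ker_mk' N, ← Subgroup.map_eq_bot_iff, Subgroup.map_commutator, eq_bot_iff,
    ← hcomm]
  exact Subgroup.commutator_mono hKmap hKmap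

variable {G : I → Type*} [∀ i, Group (G i)] [DecidableEq I] {K : Subgroup L} {ρ : L →* ∀ i, G i}
  {σ : ∀ i, G i →* L} (hσ : ∀ i, (σ i).range ≤ K) (hρσ : ∀ i g, ρ (σ i g) = Pi.mulSingle i g)

include hσ hρσ

theorem le_inf_ker_sup_iSup_range [Finite I] : K ≤ K ⊓ ρ.ker ⊔ ⨆ i, (σ i).range := by
  intro x hx
  obtain ⟨y, hy, hxy⟩ : ρ x ∈ (⨆ i, (σ i).range).map ρ := by
    refine Subgroup.pi_mem_of_mulSingle_mem _ fun i => ?_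
    rw [← hρσ]
    exact Subgroup.mem_map_of_mem ρ (Subgroup.mem_iSup_of_mem i ⟨_, rfl⟩)
  rw [← inv_mul_cancel_right x y]
  refine Subgroup.mul_mem_sup (Subgroup.mem_inf.2 ⟨mul_mem hx (inv_mem (iSup_le hσ hy)), ?_⟩) hy
  rw [MonoidHom.mem_ker, map_mul, map_inv, hxy, mul_inv_cancel]

theorem normal_range_sup_inf_ker [hK : K.Normal] (i : I) : ((σ i).range ⊔ K ⊓ ρ.ker).Normal := by
  have heq : (σ i).range ⊔ K ⊓ ρ.ker = K ⊓ (MonoidHom.mulSingle G i).range.comap ρ := by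
    refine le_antisymm (sup_le (le_inf (hσ i) ?_) ?_) ?_
    · rintro _ ⟨g, rfl⟩
      exact ⟨g, (hρσ i g).symm⟩
    · exact inf_le_inf_left K (Subgroup.ker_le_comap ρ _)
    · rintro x ⟨hx, g, hg⟩
      rw [← mul_inv_cancel_left (σ i g) x]
      refine Subgroup.mul_mem_sup ⟨g, rfl⟩
        (Subgroup.mem_inf.2 ⟨mul_mem (inv_mem (hσ i ⟨g, rfl⟩)) hx, ?_⟩)
      rw [MonoidHom.mem_ker, map_mul, map_inv, hρσ, ← hg, MonoidHom.mulSingle_apply, inv_mul_cancel]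
  have hnormal : (MonoidHom.mulSingle G i).range.Normal := by
    constructor
    rintro _ ⟨g, rfl⟩ x
    refine ⟨x i * g * (x i)⁻¹, ?_⟩
    ext j
    rcases eq_or_ne j i with rfl | hj <;> simp [*]
  rw [heq]
  infer_instance

theorem commutator_range_le_inf_ker {i j : I} (hij : i ≠ j) :
    ⁅(σ i).range, (σ j).range⁆ ≤ K ⊓ ρ.ker := by
  rw [Subgroup.commutator_le]
  rintro _ ⟨g, rfl⟩ _ ⟨h, rfl⟩
  refine Subgroup.mem_inf.2 ⟨Subgroup.commutator_le_self K
    (Subgroup.commutator_mem_commutator (hσ i ⟨g, rfl⟩) (hσ j ⟨h, rfl⟩)), ?_⟩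
  rw [MonoidHom.mem_ker, map_commutatorElement, hρσ, hρσ, commutatorElement_eq_one_iff_commute]
  exact Pi.mulSingle_commute hij g h

end SplitExtensions

section SplitLinearBlocks

variable {L I κ F : Type*} [Group L] [Finite I] [DecidableEq I] {ι : I → Type*} [∀ i, Fintype (ι i)]
  [∀ i, DecidableEq (ι i)] [Fintype κ] [DecidableEq κ] [Field F] [Finite F]
  {K : Subgroup L} [K.Normal] {ρ : L →* ∀ i, GL (ι i) F} {σ : ∀ i, GL (ι i) F →* L}

theorem commutator_map_le_map_inf_ker (p : ℕ) [Fact p.Prime] [CharP F p]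
    (hσ : ∀ i, (σ i).range ≤ K) (hρσ : ∀ i g, ρ (σ i g) = Pi.mulSingle i g)
    (hκ : 1 < Fintype.card κ) (hne : ∀ i, Fintype.card (ι i) ≠ Fintype.card κ)
    {ψ : L →* ProjGenLinGroup κ F} (hψ : Function.Surjective ψ)
    (htorsion : ∀ x ∈ K ⊓ ρ.ker, ∃ k : ℕ, ψ x ^ p ^ k = 1) :
    ⁅K.map ψ, K.map ψ⁆ ≤ (K ⊓ ρ.ker).map ψ := by
  have hPnormal : ((K ⊓ ρ.ker).map ψ).Normal := Subgroup.Normal.map inferInstance ψ hψ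
  refine commutator_le_of_le_sup_iSup (S := fun i => (ψ.comp (σ i)).range) (fun i j => ?_) ?_
  · rcases eq_or_ne i j with rfl | hij
    · have hnormal : ((ψ.comp (σ i)).range ⊔ (K ⊓ ρ.ker).map ψ).Normal := by
        rw [MonoidHom.range_comp, ← Subgroup.map_sup]
        exact (normal_range_sup_inf_ker hσ hρσ i).map ψ hψ
      rw [Subgroup.commutator_le]
      rintro _ ⟨g, rfl⟩ _ ⟨h, rfl⟩
      refine commutator_map_mem_of_card_ne p (hne i) hκ (ψ.comp (σ i)) ?_ g h
      rintro _ ⟨x, hx, rfl⟩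
      exact htorsion x hx
    · simp only [MonoidHom.range_comp, ← Subgroup.map_commutator]
      exact Subgroup.map_mono (commutator_range_le_inf_ker hσ hρσ hij)
  · simp only [MonoidHom.range_comp, ← Subgroup.map_iSup, ← Subgroup.map_sup]
    exact Subgroup.map_mono (le_inf_ker_sup_iSup_range hσ hρσ)

end SplitLinearBlocks

section Restriction

variable {Λ : Type*} [DecidableEq Λ] {r : Λ → Λ → Prop} [IsZLike r] {R : Type*} [CommRing R]

/-- Restriction to a finite convex set of indices, as a homomorphism from `U_Λ(R)`. -/
noncomputable def res (t : Finset Λ) (ht : IsConvex r (t : Set Λ)) : U r R →* GL t R :=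
  MonoidHom.toHomUnits
    { toFun := fun a => restrict a.1 t
      map_one' := restrict_one t
      map_mul' := fun a b => restrict_mul a.2.1 b.2.1 ht }

theorem coe_res (t : Finset Λ) (ht : IsConvex r (t : Set Λ)) (a : U r R) :
    (res t ht a : Matrix t t R) = restrict a.1 t := rfl

theorem res_eq_one_iff (t : Finset Λ) (ht : IsConvex r (t : Set Λ)) (a : U r R) :
    res t ht a = 1 ↔ ∀ i ∈ t, ∀ j ∈ t, a.1 i j = (1 : Matrix Λ Λ R) i j := by
  rw [Units.ext_iff, coe_res, Units.val_one, ← restrict_one, ← Matrix.ext_iff]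
  simp only [restrict, submatrix_apply, Subtype.forall]

/-- Extension of a matrix on a finite set `s` of indices by the identity outside `s`. -/
def embMat (s : Finset Λ) (g : Matrix s s R) : Matrix Λ Λ R := fun i j =>
  if h : i ∈ s ∧ j ∈ s then g ⟨i, h.1⟩ ⟨j, h.2⟩ else (1 : Matrix Λ Λ R) i j

theorem embMat_apply_of_mem {s : Finset Λ} (g : Matrix s s R) {i j : Λ} (hi : i ∈ s)
    (hj : j ∈ s) : embMat s g i j = g ⟨i, hi⟩ ⟨j, hj⟩ := dif_pos ⟨hi, hj⟩

theorem embMat_apply_of_notMem_left {s : Finset Λ} (g : Matrix s s R) {i j : Λ} (hi : i ∉ s) :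
    embMat s g i j = (1 : Matrix Λ Λ R) i j := dif_neg fun h => hi h.1

theorem embMat_apply_of_notMem_right {s : Finset Λ} (g : Matrix s s R) {i j : Λ} (hj : j ∉ s) :
    embMat s g i j = (1 : Matrix Λ Λ R) i j := dif_neg fun h => hj h.2

theorem embMat_one (s : Finset Λ) : embMat s (1 : Matrix s s R) = 1 := by
  ext i j
  by_cases h : i ∈ s ∧ j ∈ s
  · rw [embMat_apply_of_mem _ h.1 h.2, Matrix.one_apply, Matrix.one_apply]
    simp
  · exact dif_neg h

theorem mul_embMat_of_notMem {s : Finset Λ} (g : Matrix s s R) (b : Matrix Λ Λ R) {i : Λ}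
    (hi : i ∉ s) (j : Λ) : mul (embMat s g) b i j = b i j := by
  rw [mul, finsum_eq_single _ i]
  · simp [embMat_apply_of_notMem_left g hi]
  · intro k hk
    simp [embMat_apply_of_notMem_left g hi, Matrix.one_apply_ne hk.symm]

theorem mul_embMat_of_mem {s : Finset Λ} (g : Matrix s s R) (b : Matrix Λ Λ R) {i : Λ}
    (hi : i ∈ s) (j : Λ) : mul (embMat s g) b i j = ∑ k : s, g ⟨i, hi⟩ k * b k j := by
  rw [mul, finsum_eq_sum_of_support_subset (s := s)]
  · rw [← Finset.sum_coe_sort s]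
    refine Finset.sum_congr rfl fun k _ => ?_
    rw [embMat_apply_of_mem _ hi k.2]
  · intro k hk
    by_contra hks
    refine hk ?_
    change embMat s g i k * b k j = 0
    have hne : i ≠ k := fun h => hks (h ▸ hi)
    rw [embMat_apply_of_notMem_right g hks, Matrix.one_apply_ne hne, zero_mul]

theorem embMat_mul (s : Finset Λ) (g h : Matrix s s R) :
    mul (embMat s g) (embMat s h) = embMat s (g * h) := by
  ext i j
  by_cases hi : i ∈ s
  · rw [mul_embMat_of_mem _ _ hi]
    by_cases hj : j ∈ s
    · rw [embMat_apply_of_mem _ hi hj, Matrix.mul_apply]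
      exact Finset.sum_congr rfl fun k _ => by rw [embMat_apply_of_mem _ k.2 hj]
    · have hne : i ≠ j := fun h => hj (h ▸ hi)
      rw [embMat_apply_of_notMem_right _ hj, Matrix.one_apply_ne hne]
      refine Finset.sum_eq_zero fun k _ => ?_
      have hne : (k : Λ) ≠ j := fun h => hj (h ▸ k.2)
      rw [embMat_apply_of_notMem_right _ hj, Matrix.one_apply_ne hne, mul_zero]
  · rw [mul_embMat_of_notMem _ _ hi, embMat_apply_of_notMem_left _ hi,
      embMat_apply_of_notMem_left _ hi]

theorem embMat_upper {s : Finset Λ} (hs : ∀ i ∈ s, ∀ j ∈ s, r i j) (g : Matrix s s R) :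
    IsUpperTriangular r (embMat s g) := by
  intro i j hij
  have h : ¬ (i ∈ s ∧ j ∈ s) := fun h => hij (hs i h.1 j h.2)
  rw [embMat, dif_neg h]
  exact one_upper (r := r) i j hij

theorem embMat_nonsingular {s : Finset Λ} (hs : ∀ i ∈ s, ∀ j ∈ s, r i j) (g : GL s R) :
    IsNonsingular r (embMat s g.1) := by
  refine ⟨∅, by simp [IsConvex], fun t ht _ => ?_⟩
  have h1 : restrict (embMat s g.1) t * restrict (embMat s g.2) t = 1 := by
    rw [← restrict_mul (embMat_upper hs _) (embMat_upper hs _) ht, embMat_mul]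
    rw [show g.1 * g.2 = 1 from g.3, embMat_one, restrict_one]
  have h2 : restrict (embMat s g.2) t * restrict (embMat s g.1) t = 1 := by
    rw [← restrict_mul (embMat_upper hs _) (embMat_upper hs _) ht, embMat_mul]
    rw [show g.2 * g.1 = 1 from g.4, embMat_one, restrict_one]
  exact ⟨⟨_, _, h1, h2⟩, rfl⟩

/-- The general linear group of a set of equivalent indices, as a group of matrices equal to the
identity elsewhere. -/
def emb (s : Finset Λ) (hs : ∀ i ∈ s, ∀ j ∈ s, r i j) : GL s R →* U r R where
  toFun g := ⟨embMat s g.1, embMat_upper hs _, embMat_nonsingular hs g⟩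
  map_one' := Subtype.ext (embMat_one s)
  map_mul' g h := Subtype.ext (embMat_mul s g.1 h.1).symm

theorem res_emb_self (s : Finset Λ) (hs : ∀ i ∈ s, ∀ j ∈ s, r i j)
    (hc : IsConvex r (s : Set Λ)) (g : GL s R) : res s hc (emb s hs g) = g := by
  refine Units.ext ?_
  ext i j
  exact embMat_apply_of_mem _ i.2 j.2

theorem res_emb_of_disjoint {s t : Finset Λ} (hs : ∀ i ∈ s, ∀ j ∈ s, r i j)
    (ht : IsConvex r (t : Set Λ)) (hd : Disjoint s t) (g : GL s R) :
    res t ht (emb s hs g) = 1 := by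
  rw [res_eq_one_iff]
  intro i hi j _
  exact embMat_apply_of_notMem_left _ (Finset.disjoint_right.1 hd hi)

end Restriction

theorem exists_pow_eq_one_of_strictUpper {ι R : Type*} [Fintype ι] [LinearOrder ι] [CommRing R]
    (p : ℕ) [Fact p.Prime] [CharP R p] {M : Matrix ι ι R}
    (hM : ∀ i j, j ≤ i → M i j = (1 : Matrix ι ι R) i j) : ∃ k : ℕ, M ^ p ^ k = 1 := by
  rcases isEmpty_or_nonempty ι with _ | _
  · exact ⟨0, Subsingleton.elim _ _⟩
  have hzero (i j : ι) (hij : j ≤ i) : (M - 1) i j = 0 := by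
    rw [Matrix.sub_apply, hM i j hij, sub_self]
  have hnil : (M - 1) ^ Fintype.card ι = 0 := by
    have hCH := aeval_self_charpoly (M - 1)
    rw [charpoly_of_isUpperTriangular _ fun i j hij => hzero i j hij.le] at hCH
    simpa [hzero _ _ le_rfl] using hCH
  refine ⟨Fintype.card ι, ?_⟩
  have hpow : (M - 1) ^ p ^ Fintype.card ι = 0 :=
    pow_eq_zero_of_le (Nat.lt_pow_self (Fact.out : p.Prime).one_lt).le hnil
  rwa [sub_pow_char_pow_of_commute p _ (Commute.one_right M), one_pow, sub_eq_zero] at hpow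

section Parts

namespace IntervalPartition

variable {Q : IntervalPartition}

theorem rel_of_mem {p : Set ℤ} (hp : p ∈ Q.parts) (i : ℤ) (hi : i ∈ p) (j : ℤ) (hj : j ∈ p) :
    Q.rel i j := Or.inr ⟨p, hp, hi, hj⟩

theorem isConvex_part {p : Set ℤ} (hp : p ∈ Q.parts) : IsConvex Q.rel p := by
  rintro i hi j hj k (h | ⟨q, hq, h1, h2⟩) (h' | ⟨q', hq', h1', h2'⟩)
  · obtain ⟨m, n, rfl⟩ := Q.isInterval p hp
    simp only [Set.mem_Icc] at *
    omega
  · rwa [part_eq hp hq' hj h2']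
  · rwa [part_eq hp hq hi h1]
  · rwa [part_eq hp hq hi h1]

theorem subset_of_mem {p C : Set ℤ} (hp : p ∈ Q.parts) (hC : IsConvex Q.rel C) {x : ℤ}
    (hx : x ∈ p) (hxC : x ∈ C) : p ⊆ C := fun y hy =>
  hC x hxC x hxC y (rel_of_mem hp x hx y hy) (rel_of_mem hp y hy x hx)

theorem finite_part {p : Set ℤ} (hp : p ∈ Q.parts) : p.Finite := by
  obtain ⟨m, n, rfl⟩ := Q.isInterval p hp
  exact Set.finite_Icc m n

theorem mem_sizes_iff {n : ℕ} : n ∈ Q.sizes ↔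
    ∃ p : Finset ℤ, (p : Set ℤ) ∈ Q.parts ∧ p.card = n := by
  constructor
  · rintro ⟨p, hp, rfl⟩
    exact ⟨(finite_part hp).toFinset, by simpa using hp, (Set.ncard_eq_toFinset_card p _).symm⟩
  · rintro ⟨p, hp, rfl⟩
    exact ⟨p, hp, Set.ncard_coe_finset p⟩

theorem disjoint_part {p q : Finset ℤ} (hp : (p : Set ℤ) ∈ Q.parts) (hq : (q : Set ℤ) ∈ Q.parts)
    (h : p ≠ q) : Disjoint p q := by
  rw [Finset.disjoint_left]
  intro x hx hx'
  exact h (Finset.coe_injective (part_eq hp hq hx hx'))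

/-- The parts of `Q` that are contained in `D` and disjoint from `C`, as finite sets. -/
abbrev PartsAvoiding (Q : IntervalPartition) (C D : Finset ℤ) : Type :=
  {q : Finset ℤ // (q : Set ℤ) ∈ Q.parts ∧ q ⊆ D ∧ Disjoint q C}

instance (C D : Finset ℤ) : Finite (Q.PartsAvoiding C D) :=
  (D.powerset.finite_toSet.subset fun _ hq =>
    Finset.mem_coe.2 (Finset.mem_powerset.2 hq.2.1)).to_subtype

end IntervalPartition

open IntervalPartition

variable {Q : IntervalPartition} {R : Type*} [CommRing R] {C D : Finset ℤ}

/-- Restriction of a matrix to its diagonal blocks at the parts contained in `D` and disjoint from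
`C`. -/
noncomputable def resParts (Q : IntervalPartition) (R : Type*) [CommRing R] (C D : Finset ℤ) :
    U Q.rel R →* ∀ q : Q.PartsAvoiding C D, GL q.1 R :=
  MonoidHom.pi fun q => res q.1 (isConvex_part q.2.1)

theorem resParts_emb (q : Q.PartsAvoiding C D) (g : GL q.1 R) :
    resParts Q R C D (emb q.1 (rel_of_mem q.2.1) g) = Pi.mulSingle q g := by
  ext1 q'
  rcases eq_or_ne q' q with rfl | hne
  · rw [Pi.mulSingle_eq_same]
    exact res_emb_self _ _ (isConvex_part q'.2.1) g
  · rw [Pi.mulSingle_eq_of_ne hne]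
    exact res_emb_of_disjoint _ (isConvex_part q'.2.1)
      (disjoint_part q.2.1 q'.2.1 fun h => hne (Subtype.ext h.symm)) g

theorem apply_eq_one_of_le {hC : IsConvex Q.rel (C : Set ℤ)} (hD : IsConvex Q.rel (D : Set ℤ))
    {g : U Q.rel R} (hgC : res C hC g = 1) (hg : resParts Q R C D g = 1) {i j : ℤ} (hi : i ∈ D)
    (hji : j ≤ i) : g.1 i j = (1 : Matrix ℤ ℤ R) i j := by
  by_cases hij : Q.rel i j
  · obtain ⟨q, hq, hiq, hjq⟩ := hij.resolve_left hji.not_gt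
    obtain ⟨q, rfl⟩ := (finite_part hq).exists_finset_coe
    by_cases hqC : Disjoint q C
    · have hres : res q (isConvex_part hq) g = 1 :=
        congrFun hg ⟨q, hq, subset_of_mem hq hD hiq hi, hqC⟩
      exact (res_eq_one_iff q _ g).1 hres i hiq j hjq
    · obtain ⟨x, hxq, hxC⟩ := Finset.not_disjoint_iff.1 hqC
      have hle := subset_of_mem hq hC hxq hxC
      exact (res_eq_one_iff C hC g).1 hgC i (hle hiq) j (hle hjq)
  · rw [g.2.1 i j hij, one_upper (r := Q.rel) i j hij]

variable {κ F : Type*} [Fintype κ] [DecidableEq κ] [Field F] [Finite F]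

theorem exists_commutator_pow_eq_one_of_notMem_sizes (p : ℕ) [Fact p.Prime] [CharP F p]
    (hκ : 1 < Fintype.card κ) (hsizes : Fintype.card κ ∉ Q.sizes)
    {hC : IsConvex Q.rel (C : Set ℤ)} {hD : IsConvex Q.rel (D : Set ℤ)}
    {L : Subgroup (U Q.rel F)} (hL : (res C hC).ker ≤ L) {ψ : L →* ProjGenLinGroup κ F}
    (hψ : Function.Surjective ψ) (hker : ∀ g : L, res D hD g.1 = 1 → ψ g = 1) :
    ∀ x ∈ ((res C hC).ker.subgroupOf L).map ψ, ∀ y ∈ ((res C hC).ker.subgroupOf L).map ψ,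
      ∃ k : ℕ, ⁅x, y⁆ ^ p ^ k = 1 := by
  let K := (res C hC).ker.subgroupOf L
  let ρ := (resParts Q F C D).comp L.subtype
  have hemb (q : Q.PartsAvoiding C D) (g : GL q.1 F) :
      emb q.1 (rel_of_mem q.2.1) g ∈ (res C hC).ker := res_emb_of_disjoint _ hC q.2.2.2 g
  let σ (q : Q.PartsAvoiding C D) : GL q.1 F →* L :=
    (emb q.1 (rel_of_mem q.2.1)).codRestrict L fun g => hL (hemb q g)
  have hσ (q) : (σ q).range ≤ K := by
    rintro _ ⟨g, rfl⟩
    exact hemb q g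
  have hne (q : Q.PartsAvoiding C D) : Fintype.card q.1 ≠ Fintype.card κ := fun h =>
    hsizes (mem_sizes_iff.2 ⟨q.1, q.2.1, (Fintype.card_coe q.1).symm.trans h⟩)
  have htorsion : ∀ x ∈ K ⊓ ρ.ker, ∃ k : ℕ, ψ x ^ p ^ k = 1 := by
    rintro x ⟨hxC, hx⟩
    obtain ⟨k, hk⟩ := exists_pow_eq_one_of_strictUpper p (M := restrict x.1.1 D) fun i j hji =>
      (apply_eq_one_of_le hD hxC hx i.2 hji).trans (congrFun₂ (restrict_one D) i j)
    refine ⟨k, ?_⟩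
    rw [← map_pow]
    refine hker _ ?_
    rw [Subgroup.coe_pow, map_pow]
    exact Units.ext hk
  intro x hx y hy
  obtain ⟨z, hz, hxy⟩ := commutator_map_le_map_inf_ker p hσ (resParts_emb ·) hκ hne hψ htorsion
    (Subgroup.commutator_mem_commutator hx hy)
  exact hxy ▸ htorsion z hz

end Parts

section Inclusion

variable {Λ : Type*} (r : Λ → Λ → Prop) [IsZLike r]

theorem finite_adjoin_diff (s : Finset Λ) :
    {x : Λ × Λ | ¬ r x.1 x.2 ∧ adjoin r (s : Set Λ) x.1 x.2}.Finite := by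
  obtain ⟨t, ht, hc⟩ := IsZLike.exists_stronglyConvex (r := r) s
  refine (t ×ˢ t).finite_toSet.subset ?_
  rintro ⟨i, j⟩ ⟨hij, h⟩
  obtain ⟨x, hx, y, hy, hix, hyj⟩ := ((adjoin_iff r _ _ _).1 h).resolve_left hij
  refine Finset.mem_coe.2 (Finset.mem_product.2 ⟨?_, ?_⟩)
  · by_contra hi
    rcases hc i hi with h | h
    · exact hij (trans_of r (h y (ht hy)).1 hyj)
    · exact (h x (ht hx)).2 ⟨(h x (ht hx)).1, hix⟩
  · by_contra hj
    rcases hc j hj with h | h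
    · exact (h y (ht hy)).2 ⟨(h y (ht hy)).1, hyj⟩
    · exact hij (trans_of r hix (h x (ht hx)).1)

variable {r} [DecidableEq Λ] {R : Type*} [CommRing R]

/-- The inclusion of `U_Λ(R)` in `AU_Λ(R)`. -/
def toAU : U r R →* AU r R where
  toFun a := ⟨a.1, Set.finite_empty.subset fun x hx => hx.2 (a.2.1 x.1 x.2 hx.1), a.2.2⟩
  map_one' := rfl
  map_mul' _ _ := rfl

theorem toAU_injective : Function.Injective (toAU : U r R → AU r R) := fun _ _ h =>
  Subtype.ext (congrArg (fun x : AU r R => x.1) h)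

theorem preimage_inclusion_image_toAU (s : Finset Λ) (O : Set (Matrix Λ Λ R)) :
    inclusion r s ⁻¹' (toAU '' (Subtype.val ⁻¹' O : Set (U r R))) =
      Subtype.val ⁻¹' O ∩ {a | ∀ x ∈ (finite_adjoin_diff r s).toFinset, a.1 x.1 x.2 = 0} := by
  ext a
  simp only [Set.Finite.mem_toFinset, Set.mem_ofPred_eq]
  constructor
  · rintro ⟨b, hb, hba⟩
    have hval : b.1 = a.1 := congrArg (fun x : AU r R => x.1) hba
    exact ⟨show a.1 ∈ O from hval ▸ hb, fun x hx => hval ▸ b.2.1 x.1 x.2 hx.1⟩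
  · rintro ⟨haO, ha⟩
    refine ⟨⟨a.1, fun i j hij => ?_, (almostUpper_of_adjoin s a.2.1 a.2.2).2⟩, haO, rfl⟩
    by_cases h : adjoin r (s : Set Λ) i j
    · exact ha (i, j) ⟨hij, h⟩
    · exact a.2.1 i j h

end Inclusion

section Topology

variable {Λ : Type*} [DecidableEq Λ] {r : Λ → Λ → Prop} {R : Type*} [CommRing R]
  [TopologicalSpace R]

theorem continuous_entry (i j : Λ) : Continuous fun a : U r R => a.1 i j :=
  (continuous_apply_apply i j).comp continuous_induced_dom

instance {n : Type*} [Fintype n] [DecidableEq n] [DiscreteTopology R] :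
    DiscreteTopology (ProjGenLinGroup n R) :=
  discreteTopology_iff_forall_isOpen.2 fun _ => isOpen_coinduced.2 (isOpen_discrete _)

variable [IsZLike r]

theorem continuous_res [DiscreteTopology R] (t : Finset Λ) (ht : IsConvex r (t : Set Λ)) :
    Continuous (res t ht : U r R →* GL t R) := by
  have hrestrict : Continuous fun a : U r R => restrict a.1 t :=
    continuous_matrix fun i j => continuous_entry i.1 j.1
  refine continuous_discrete_rng.2 fun g => ?_
  convert (isOpen_discrete {(g : Matrix t t R)}).preimage hrestrict using 1
  ext a
  exact Units.ext_iff

theorem isOpen_ker_res [DiscreteTopology R] (t : Finset Λ) (ht : IsConvex r (t : Set Λ)) :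
    IsOpen ((res t ht : U r R →* GL t R).ker : Set (U r R)) :=
  (isOpen_discrete {1}).preimage (continuous_res t ht)

theorem exists_ker_res_subset {S : Set (U r R)} (hS : IsOpen S) (h1 : (1 : U r R) ∈ S) :
    ∃ (t : Finset Λ) (ht : IsConvex r (t : Set Λ)),
      ((res t ht : U r R →* GL t R).ker : Set (U r R)) ⊆ S := by
  obtain ⟨O, hO, rfl⟩ := isOpen_induced_iff.1 hS
  obtain ⟨I, u, hu, hIu⟩ := isOpen_pi_iff.1 hO _ h1
  have hrow (i : I) : ∃ J : Finset Λ, ∀ f : Λ → R,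
      (∀ j ∈ J, f j = (1 : Matrix Λ Λ R) i j) → f ∈ u i := by
    obtain ⟨J, v, hv, hJv⟩ := isOpen_pi_iff.1 (hu i i.2).1 _ (hu i i.2).2
    exact ⟨J, fun f hf => hJv fun j hj => hf j hj ▸ (hv j hj).2⟩
  choose J hJ using hrow
  obtain ⟨t, ht, hc⟩ := exists_convex r (I ∪ Finset.univ.biUnion J)
  refine ⟨t, hc, fun a ha => hIu fun i hi => hJ ⟨i, hi⟩ _ fun j hj => ?_⟩
  exact (res_eq_one_iff t hc a).1 ha i (ht (Finset.mem_union_left _ hi)) j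
    (ht (Finset.mem_union_right _ (Finset.mem_biUnion.2 ⟨⟨i, hi⟩, Finset.mem_univ _, hj⟩)))

theorem exists_forall_res_eq_one_imp {H : Type*} [Group H] [TopologicalSpace H]
    [DiscreteTopology H] {L : Subgroup (U r R)} (hL : IsOpen (L : Set (U r R))) {ψ : L →* H}
    (hψ : Continuous ψ) : ∃ (t : Finset Λ) (ht : IsConvex r (t : Set Λ)),
      ∀ g : L, res t ht g.1 = 1 → ψ g = 1 := by
  obtain ⟨t, ht, hker⟩ := exists_ker_res_subset
    (hL.isOpenMap_subtype_val _ ((isOpen_discrete {1}).preimage hψ)) ⟨1, map_one ψ, rfl⟩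
  refine ⟨t, ht, fun g hg => ?_⟩
  obtain ⟨g', hg', hgg'⟩ := hker hg
  rwa [Subtype.ext hgg'] at hg'

theorem isOpen_AU_iff {S : Set (AU r R)} :
    IsOpen S ↔ ∀ s : {s : Finset Λ // IsConvex r (s : Set Λ)}, IsOpen (inclusion r s.1 ⁻¹' S) := by
  rw [isOpen_iSup_iff]
  exact forall_congr' fun s => isOpen_coinduced

theorem continuous_toAU : Continuous (toAU : U r R → AU r R) := by
  rw [continuous_def]
  intro S hS
  let toAdjoin : U r R → U (adjoin r ((∅ : Finset Λ) : Set Λ)) R := fun a =>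
    ⟨a.1, fun i j h => a.2.1 i j fun h' => h (.single (Or.inl h')), nonsingular_adjoin ∅ a.2.2⟩
  have hcont : Continuous toAdjoin := continuous_induced_rng.2 continuous_induced_dom
  exact (isOpen_AU_iff.1 hS ⟨∅, by simp [IsConvex]⟩).preimage hcont

variable [DiscreteTopology R]

theorem isOpenMap_toAU : IsOpenMap (toAU : U r R → AU r R) := by
  intro S hS
  obtain ⟨O, hO, rfl⟩ := isOpen_induced_iff.1 hS
  refine isOpen_AU_iff.2 fun s => ?_
  rw [preimage_inclusion_image_toAU]
  refine (hO.preimage continuous_induced_dom).inter ?_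
  simp only [Set.ofPred_forall]
  exact isOpen_biInter_finset fun x _ =>
    (isOpen_discrete {0}).preimage (continuous_entry x.1 x.2)

theorem isOpenEmbedding_toAU : IsOpenEmbedding (toAU : U r R → AU r R) :=
  .of_continuous_injective_isOpenMap continuous_toAU toAU_injective isOpenMap_toAU

end Topology

theorem LocallyIsomorphic.exists_isOpenEmbedding {G H G' H' : Type*} [Group G]
    [TopologicalSpace G] [Group H] [TopologicalSpace H] [Group G'] [TopologicalSpace G'] [Group H']
    [TopologicalSpace H'] {i : G' →* G} {j : H' →* H} (hi : IsOpenEmbedding i)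
    (hj : IsOpenEmbedding j)
    (hbasis : ∀ S : Set G', IsOpen S → 1 ∈ S →
      ∃ W : Subgroup G', IsOpen (W : Set G') ∧ (W : Set G') ⊆ S)
    (h : LocallyIsomorphic G H) :
    ∃ W : Subgroup G', IsOpen (W : Set G') ∧ ∃ θ : W →* H', IsOpenEmbedding θ := by
  obtain ⟨V, φ, hV, h1V, hφ, hmul, -⟩ := h
  have hφ1 : φ ⟨1, h1V⟩ = 1 := by
    simpa using hmul ⟨1, h1V⟩ ⟨1, h1V⟩ (by simpa using h1V)
  obtain ⟨W, hW, hWS⟩ := hbasis (i ⁻¹' (Subtype.val '' (φ ⁻¹' Set.range j)))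
    ((hV.isOpenMap_subtype_val _ (hj.isOpen_range.preimage hφ.continuous)).preimage hi.continuous)
    ⟨⟨1, h1V⟩, ⟨1, by rw [map_one, hφ1]⟩, (map_one i).symm⟩
  have hWV (w : W) : i w ∈ V := by
    obtain ⟨v, -, hv⟩ := hWS w.2
    exact hv ▸ v.2
  have hlift (w : W) : ∃ y : H', j y = φ ⟨i w, hWV w⟩ := by
    obtain ⟨v, ⟨y, hy⟩, hv⟩ := hWS w.2
    exact ⟨y, hy.trans (congrArg φ (Subtype.ext hv))⟩
  choose θ hθ using hlift
  have hθmul (a b : W) : θ (a * b) = θ a * θ b := hj.injective <| by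
    rw [map_mul, hθ, hθ, hθ, ← hmul _ _ (map_mul i a.1 b.1 ▸ hWV (a * b))]
    exact congrArg φ (Subtype.ext (map_mul i a.1 b.1))
  have hiW : IsOpenEmbedding fun w : W => (⟨i w, hWV w⟩ : V) :=
    .of_comp _ hV.isOpenEmbedding_subtypeVal (hi.comp hW.isOpenEmbedding_subtypeVal)
  exact ⟨W, hW, MonoidHom.mk' θ hθmul,
    .of_comp _ hj ((funext hθ : j ∘ θ = _) ▸ hφ.comp hiW)⟩

theorem card_le_card_of_ker_le {G H K : Type*} [Group G] [Group H] [Group K] [Finite K]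
    {f : G →* K} {ψ : G →* H} (hψ : Function.Surjective ψ) (h : f.ker ≤ ψ.ker) :
    Nat.card H ≤ Nat.card K := by
  rw [← Subgroup.card_top (G := H), ← MonoidHom.range_eq_top.2 hψ, ← Subgroup.index_ker]
  exact Nat.le_of_dvd Nat.card_pos
    ((Subgroup.index_dvd_of_le h).trans (Subgroup.index_ker f ▸ Subgroup.card_subgroup_dvd_card _))

section Quotients

open IntervalPartition

variable {Q : IntervalPartition} {F : Type*} [Field F] {κ : Type*} [Fintype κ] [DecidableEq κ]

/-- The map to `PGL_κ` given by the diagonal block of a part indexed by `κ`. -/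
noncomputable def blockPGL {q : Finset ℤ} (hq : (q : Set ℤ) ∈ Q.parts) (e : q ≃ κ) :
    U Q.rel F →* ProjGenLinGroup κ F :=
  (ProjGenLinGroup.mk.comp
    (Units.mapEquiv (reindexAlgEquiv F F e).toMulEquiv).toMonoidHom).comp (res q (isConvex_part hq))

theorem exists_blockPGL_emb_eq {q : Finset ℤ} (hq : (q : Set ℤ) ∈ Q.parts) (e : q ≃ κ)
    (x : ProjGenLinGroup κ F) : ∃ g : GL q F, blockPGL hq e (emb q (rel_of_mem hq) g) = x := by
  obtain ⟨y, rfl⟩ := ProjGenLinGroup.mk_surjective x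
  let E := Units.mapEquiv (reindexAlgEquiv F F e).toMulEquiv
  refine ⟨E.symm y, ?_⟩
  rw [blockPGL, MonoidHom.comp_apply, res_emb_self, MonoidHom.comp_apply]
  exact congrArg _ (E.apply_symm_apply y)

variable [TopologicalSpace F] [DiscreteTopology F]

theorem continuous_blockPGL {q : Finset ℤ} (hq : (q : Set ℤ) ∈ Q.parts) (e : q ≃ κ) :
    Continuous (blockPGL hq e : U Q.rel F →* ProjGenLinGroup κ F) :=
  (continuous_of_discreteTopology (f := ProjGenLinGroup.mk.comp
    (Units.mapEquiv (reindexAlgEquiv F F e).toMulEquiv).toMonoidHom)).comp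
      (continuous_res q (isConvex_part hq))

theorem exists_surjective_of_mem_sizes (h : Fintype.card κ ∈ Q.sizes) :
    ∃ φ : U Q.rel F →* ProjGenLinGroup κ F, Continuous φ ∧ Function.Surjective φ := by
  obtain ⟨q, hq, hcard⟩ := mem_sizes_iff.1 h
  let e : q ≃ κ := Fintype.equivOfCardEq ((Fintype.card_coe q).trans hcard)
  refine ⟨blockPGL hq e, continuous_blockPGL hq e, fun x => ?_⟩
  obtain ⟨g, hg⟩ := exists_blockPGL_emb_eq hq e x
  exact ⟨_, hg⟩

variable [Finite F]

theorem mem_sizes_of_surjective (hκ : 1 < Fintype.card κ) {φ : U Q.rel F →* ProjGenLinGroup κ F}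
    (hφ : Continuous φ) (hsurj : Function.Surjective φ) : Fintype.card κ ∈ Q.sizes := by
  by_contra hsizes
  obtain ⟨p, hp⟩ := CharP.exists F
  have : Fact p.Prime := ⟨CharP.char_is_prime F p⟩
  obtain ⟨D, hD, hker⟩ := exists_forall_res_eq_one_imp (L := (⊤ : Subgroup (U Q.rel F)))
    (ψ := φ.comp (Subgroup.subtype ⊤)) isOpen_univ (hφ.comp continuous_subtype_val)
  have hC : IsConvex Q.rel ((∅ : Finset ℤ) : Set ℤ) := by simp [IsConvex]
  have htorsion := exists_commutator_pow_eq_one_of_notMem_sizes p hκ hsizes (hC := hC) le_top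
    (hsurj.comp fun x => ⟨⟨x, trivial⟩, rfl⟩) hker
  have hall (x : ProjGenLinGroup κ F) :
      x ∈ ((res ∅ hC).ker.subgroupOf ⊤).map (φ.comp (Subgroup.subtype ⊤)) := by
    obtain ⟨y, rfl⟩ := hsurj x
    exact ⟨⟨y, trivial⟩, Subsingleton.elim _ _, rfl⟩
  obtain ⟨i, j, hij⟩ := Fintype.exists_pair_of_one_lt_card hκ
  obtain ⟨s, hs⟩ := exists_commutator_pow_ne_one F p hij
  obtain ⟨k, hk⟩ := htorsion _ (hall _) _ (hall _)
  exact hs k hk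

theorem card_le_of_notMem_sizes_of_surjective (hκ : 2 < Fintype.card κ)
    (hsizes : Fintype.card κ ∉ Q.sizes) {C : Finset ℤ} {hC : IsConvex Q.rel (C : Set ℤ)}
    {L : Subgroup (U Q.rel F)} (hL : IsOpen (L : Set (U Q.rel F))) (hCL : (res C hC).ker ≤ L)
    {ψ : L →* ProjGenLinGroup κ F} (hψ : Continuous ψ) (hsurj : Function.Surjective ψ) :
    Fintype.card κ ≤ C.card := by
  obtain ⟨p, hp⟩ := CharP.exists F
  have : Fact p.Prime := ⟨CharP.char_is_prime F p⟩
  obtain ⟨D, hD, hker⟩ := exists_forall_res_eq_one_imp hL hψ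
  have : (((res C hC).ker.subgroupOf L).map ψ).Normal := Subgroup.Normal.map inferInstance ψ hsurj
  have hbot : ((res C hC).ker.subgroupOf L).map ψ = ⊥ := eq_bot_of_commutator_pow_eq_one p hκ
    (exists_commutator_pow_eq_one_of_notMem_sizes p (by omega) hsizes hCL hsurj hker)
  have hle : Nat.card (ProjGenLinGroup κ F) ≤ Nat.card (GL C F) :=
    card_le_card_of_ker_le (f := (res C hC).comp L.subtype) hsurj
      ((Subgroup.map_eq_bot_iff _).1 hbot)
  obtain ⟨i, j, hij⟩ := Fintype.exists_pair_of_one_lt_card (one_lt_two.trans hκ)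
  have hnontrivial : (⊤ : Subgroup (ProjGenLinGroup κ F)) ≠ ⊥ := fun h => by
    obtain ⟨s, hs⟩ := exists_commutator_pow_ne_one F p hij
    exact hs 0 (by rw [pow_zero, pow_one]; exact Subgroup.mem_bot.1 (h ▸ Subgroup.mem_top _))
  by_contra! hlt
  have hcard := card_GL_lt_card_of_ne_bot (ι := C) (by simpa using hlt) hκ hnontrivial
  rw [Subgroup.card_top] at hcard
  exact hcard.not_ge hle

theorem finite_sizes_diff {Q' : IntervalPartition} {L : Subgroup (U Q.rel F)}
    (hL : IsOpen (L : Set (U Q.rel F))) {θ : L →* U Q'.rel F} (hθ : Continuous θ)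
    (hrange : IsOpen (θ.range : Set (U Q'.rel F))) : (Q'.sizes \ Q.sizes).Finite := by
  obtain ⟨C, hC, hCL⟩ := exists_ker_res_subset hL L.one_mem
  obtain ⟨D, hD, hDθ⟩ := exists_ker_res_subset hrange θ.range.one_mem
  refine (Set.finite_le_nat (max 2 (max D.card C.card))).subset ?_
  rintro n ⟨hn', hn⟩
  by_contra hlt
  simp only [Set.mem_ofPred_eq, not_le, max_lt_iff] at hlt
  obtain ⟨hn2, hnD, hnC⟩ := hlt
  obtain ⟨q, hq, rfl⟩ := mem_sizes_iff.1 hn'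
  have hqD : Disjoint q D := Finset.disjoint_left.2 fun y hyq hyD =>
    hnD.not_ge (Finset.card_le_card (subset_of_mem hq hD hyq hyD))
  have hsurj : Function.Surjective ((blockPGL hq (Equiv.refl q)).comp θ) := fun x => by
    obtain ⟨g, hg⟩ := exists_blockPGL_emb_eq hq (Equiv.refl q) x
    obtain ⟨l, hl⟩ := hDθ (res_emb_of_disjoint (rel_of_mem hq) hD hqD g)
    exact ⟨l, by rw [MonoidHom.comp_apply, hl, hg]⟩
  have hcard := card_le_of_notMem_sizes_of_surjective (κ := q) (by simpa using hn2)
    (by simpa using hn) hL hCL ((continuous_blockPGL hq _).comp hθ) hsurj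
  exact hnC.not_ge (by simpa using hcard)

theorem finite_symmDiff_sizes {Q₁ Q₂ : IntervalPartition}
    (h : LocallyIsomorphic (AU Q₁.rel F) (AU Q₂.rel F)) : (symmDiff Q₁.sizes Q₂.sizes).Finite := by
  obtain ⟨W, hW, θ, hθ⟩ := h.exists_isOpenEmbedding isOpenEmbedding_toAU isOpenEmbedding_toAU
    fun S hS h1 => by
      obtain ⟨t, ht, htS⟩ := exists_ker_res_subset hS h1
      exact ⟨_, isOpen_ker_res t ht, htS⟩
  have hrange : IsOpen (θ.range : Set (U Q₂.rel F)) := hθ.isOpen_range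
  let e : W ≃* θ.range := MonoidHom.ofInjective hθ.injective
  have he : IsOpenEmbedding e := .of_comp e hrange.isOpenEmbedding_subtypeVal hθ
  have hsymm : Continuous e.symm :=
    (e.toEquiv.toHomeomorphOfIsInducing he.isInducing).symm.continuous
  refine (finite_sizes_diff (θ := W.subtype.comp e.symm.toMonoidHom) hrange
    (continuous_subtype_val.comp hsymm) ?_).union (finite_sizes_diff hW hθ.continuous hrange)
  rwa [MonoidHom.range_comp, MonoidHom.range_eq_top.2 e.symm.surjective,
    ← MonoidHom.range_eq_map, Subgroup.range_subtype]

end Quotients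

end InfMatrix

theorem mainTheorem3_general {F : Type*} [Field F] [Finite F] [TopologicalSpace F]
    [DiscreteTopology F] :
    (∀ (Q : InfMatrix.IntervalPartition) (n : ℕ), 1 < n →
      ((∃ φ : InfMatrix.U Q.rel F →* Matrix.ProjGenLinGroup (Fin n) F,
          Continuous φ ∧ Function.Surjective φ) ↔ n ∈ Q.sizes)) ∧
    (∀ Q₁ Q₂ : InfMatrix.IntervalPartition,
      InfMatrix.LocallyIsomorphic (InfMatrix.AU Q₁.rel F) (InfMatrix.AU Q₂.rel F) →
        (symmDiff Q₁.sizes Q₂.sizes).Finite) := by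
  refine ⟨fun Q n hn => ⟨?_, fun hmem => ?_⟩, fun _ _ => InfMatrix.finite_symmDiff_sizes⟩
  · rintro ⟨φ, hφ, hsurj⟩
    simpa only [Fintype.card_fin] using
      InfMatrix.mem_sizes_of_surjective (by rwa [Fintype.card_fin]) hφ hsurj
  · exact InfMatrix.exists_surjective_of_mem_sizes (by rwa [Fintype.card_fin])

theorem mainTheorem3 {F : Type*} [Field F] [Finite F] [TopologicalSpace F] [DiscreteTopology F] :
    (∀ (Q : InfMatrix.IntervalPartition) (n : ℕ), 1 < n → (Nat.card F = 3 → 2 < n) →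
      ((∃ φ : InfMatrix.U Q.rel F →* Matrix.ProjGenLinGroup (Fin n) F,
          Continuous φ ∧ Function.Surjective φ) ↔ n ∈ Q.sizes)) ∧
    (∀ Q₁ Q₂ : InfMatrix.IntervalPartition,
      InfMatrix.LocallyIsomorphic (InfMatrix.AU Q₁.rel F) (InfMatrix.AU Q₂.rel F) →
        (symmDiff Q₁.sizes Q₂.sizes).Finite) :=
  ⟨fun Q n hn _ => mainTheorem3_general.1 Q n hn, mainTheorem3_general.2⟩
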